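/- Let $O\subset\mathbb R^n\times\mathbb R^m$ be open and let $x_+=f(x,u)$, $f\colon O\to\mathbb R^n$, be a $C^\infty$ discrete-time system such that $f$ is a submersion and $\operatorname{rank}\partial_u f=m$ on $O$. Fix $p=(x_0,u_0)\in O$. All distributions are smooth and regular (locally of constant dimension); put $U=\operatorname{span}\{\partial_{u^1},\dots,\partial_{u^m}\}$. A smooth vector field $v$ on an open set $N\subset O$ is *projectable* if $f_*v$ is a well-defined smooth vector field on $f(N)$, i.e. $df(v)=Y\circ f$ on $N$ for a smooth vector field $Y$ on $f(N)$. For a distribution $W\subset U$ let $P_1\subset\operatorname{span}(df^1,\dots,df^n)$ be the largest codistribution with $W\rfloor P_1=0$. A codistribution is *integrable* if it locally has a basis of exact differentials. A vector field $c$ is *Cauchy characteristic* for $P$ if $c\rfloor P=0$ and $c\rfloor dP\subset P$. *Normal form.* For $1\le k\le m$ we say that the system can be transformed near $p$ to the normal form with $m_w=k$ if, with $m_v=m-k$, there are a smooth input transformation $(x,u)\mapsto(x,v,w)$, $v\in\mathbb R^{m_v}$, $w\in\mathbb R^{m_w}$, that is a diffeomorphism of a neighbourhood of $p$ onto its image,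 and a diffeomorphism $h$ between open (possibly disconnected) subsets of $\mathbb R^n$ whose image contains neighbourhoods of $x_0$ and of $f(p)$, such that $x=h(\tilde x)$, $x_+=h(\tilde x_+)$ bring the system near $p$ into the form $$\tilde x_+=\bigl(\tilde g(\tilde x,v),\,v,\,w\bigr),\qquad \tilde g\ \text{smooth with values in }\mathbb R^{n-m}.$$ **(A)** For every $k\ge1$, the system can be transformed near $p$ to the normal form with $m_w=k$ if and only if on some neighbourhood $N\subset O$ of $p$ there is a distribution $W\subset U$ such that 1. $\dim W=k$, and $W$ has a basis $w_1,\dots,w_k$ of projectable vector fields; 2. $P_1$ is integrable, and $W$ is the Cauchy characteristic distribution of $P_1$ within $U$: the sections of $W$ are exactly the Cauchy characteristic fields of $P_1$ that lie in $U$; 3. there is an involutive distribution $V$ with $V\oplus W=U$. **(B)** Let $W$, $\dim W=k\ge1$, satisfy 1 and 2 on a neighbourhood $N$ of $p$. Then $W$ is involutive, and 3 holds on some neighbourhood of $p$. If near $p$ there is no projectable field in $U$ outside $W$ (each projectable field in $U$ on a neighbourhood of $p$ lies in $W$ near $p$), then $k$ is maximal: it is the largest dimension of a distribution satisfying 1 near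 $p$ and the largest $m_w$ for which the normal form is attained near $p$. Conversely, if the projectable fields in $U$ span a regular distribution near $p$ (some distribution with a basis of projectable fields in $U$ contains all projectable fields in $U$ near $p$) and $k$ is the largest dimension of a distribution satisfying 1 near $p$, then near $p$ there is no projectable field in $U$ outside $W$. **(C)** (Construction.) Let $W$ be as in (B), and put $m_w=k$, $m_v=m-k$. Near $p$ there are smooth $g^1,\dots,g^{n-m_w}$ whose differentials form a basis of $P_1$. Given any such functions near $p$, one can sort the $g^i$ and select $m_w$ of the $f^j$ so that, with $v=(g^{n-m+1},\dots,g^{n-m_w})$ and $w=(f^{j_1},\dots,f^{j_{m_w}})$, the partial derivative $\partial_u(v,w)$ is invertible at $p$. For every such choice, $(x,u)\mapsto(x,v,w)$ is a diffeomorphism near $p$ which turns $W$ into $\operatorname{span}\{\partial_{w^1},\dots,\partial_{w^{m_w}}\}$; write $u=q^{-1}(v,w)$ for fixed $x$. In the new coordinates $g^i=\hat g^i(x,v)$ for $i\le n-m$; the functions $\hat g^1,\dots,\hat g^{n-m}$ can be completed by $m$ functions of $(x,v)$ to a map $z=p_v(x)\in\mathbb R^n$ such that $(x,v)\mapsto(z,v)$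 is a local diffeomorphism; and there is a diffeomorphism $h$ as in the normal form with $$f\bigl(p_v^{-1}(z),\,q^{-1}(v,w)\bigr)=h(z^1,\dots,z^{n-m},v,w),$$ such that $x=h(\tilde x)$, $x_+=h(\tilde x_+)$ and the inputs $(v,w)$ give the normal form with $\tilde g(\tilde x,v)=(\hat g^1,\dots,\hat g^{n-m})(h(\tilde x),v)$. -/

import Mathlib

open scoped ContDiff Topology

/-- Coordinate space with `n` real coordinates. -/
abbrev RVec (n : ℕ) : Type := Fin n → ℝ

/-- A (pointwise) distribution: a subspace of the tangent space at every point. -/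
abbrev TangentDistribution (E : Type*) [NormedAddCommGroup E] [NormedSpace ℝ E] : Type _ :=
  E → Submodule ℝ E

/-- A (pointwise) codistribution: a subspace of the cotangent space at every point. -/
abbrev Codistribution (E : Type*) [NormedAddCommGroup E] [NormedSpace ℝ E] : Type _ :=
  E → Submodule ℝ (E →L[ℝ] ℝ)

section General

variable {E : Type*} [NormedAddCommGroup E] [NormedSpace ℝ E]
variable {F : Type*} [NormedAddCommGroup F] [NormedSpace ℝ F]

/-- The vector fields `w i` are smooth on `N` and form a basis of the distribution `D` at every
point of `N`. -/
def IsFrameOn {k : ℕ} (w : Fin k → E → E) (D : TangentDistribution E) (N : Set E) : Prop :=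
  (∀ i, ContDiffOn ℝ ∞ (w i) N) ∧
    ∀ q ∈ N, LinearIndependent ℝ (fun i => w i q) ∧
      D q = Submodule.span ℝ (Set.range fun i => w i q)

/-- `D` is involutive on `N`: the Lie bracket of two smooth local sections is a section. -/
def IsInvolutiveOn (D : TangentDistribution E) (N : Set E) : Prop :=
  ∀ N' ⊆ N, IsOpen N' → ∀ a b : E → E, ContDiffOn ℝ ∞ a N' → ContDiffOn ℝ ∞ b N' →
    (∀ q ∈ N', a q ∈ D q) → (∀ q ∈ N', b q ∈ D q) →
      ∀ q ∈ N', VectorField.lieBracket ℝ a b q ∈ D q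

/-- The smooth vector field `v` on `N` is projectable by `f`: its push-forward is a well-defined
smooth vector field `Y` on the image `f(N)`. -/
def IsProjectableOn (f : E → F) (v : E → E) (N : Set E) : Prop :=
  ContDiffOn ℝ ∞ v N ∧
    ∃ Y : F → F, ContDiffOn ℝ ∞ Y (f '' N) ∧ ∀ q ∈ N, fderiv ℝ f q (v q) = Y (f q)

/-- The contraction `c ⌋ dα` at `q` of the exterior derivative of the one-form `α` with the tangent
vector `c`. -/
noncomputable def contractExtDeriv (α : E → E →L[ℝ] ℝ) (q c : E) : E →L[ℝ] ℝ :=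
  fderiv ℝ α q c - (fderiv ℝ α q).flip c

/-- The contraction agrees with Mathlib's exterior derivative. -/
theorem contractExtDeriv_apply (α : E → E →L[ℝ] ℝ) (q c b : E) (hα : DifferentiableAt ℝ α q) :
    contractExtDeriv α q c b =
      extDeriv (fun y => ContinuousAlternatingMap.ofSubsingleton ℝ E ℝ (0 : Fin 1) (α y)) q
        ![c, b] := by
  have h1 : DifferentiableAt ℝ
      (fun y => ContinuousAlternatingMap.ofSubsingleton ℝ E ℝ (0 : Fin 1) (α y)) q :=
    ((ContinuousAlternatingMap.ofSubsingletonLIE (𝕜 := ℝ) (E := E) (F := ℝ)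
      (0 : Fin 1)).differentiable _).comp q hα
  rw [extDeriv_apply h1]
  have h2 : ∀ e d : E, fderiv ℝ (fun y => α y e) q d = fderiv ℝ α q d e := by
    intro e d
    rw [fderiv_clm_apply hα (differentiableAt_const e)]
    simp
  simp [contractExtDeriv, Fin.sum_univ_two, Fin.removeNth, h2, sub_eq_add_neg]

/-- The smooth functions `g i` have differentials forming a basis of the codistribution `P` at every
point of `N`. -/
def IsExactBasisOn {ι : Type*} (g : ι → E → ℝ) (P : Codistribution E) (N : Set E) : Prop :=
  (∀ i, ContDiffOn ℝ ∞ (g i) N) ∧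
    ∀ q ∈ N, LinearIndependent ℝ (fun i => fderiv ℝ (g i) q) ∧
      P q = Submodule.span ℝ (Set.range fun i => fderiv ℝ (g i) q)

/-- `P` is integrable on `N`: locally it has a basis of exact differentials. -/
def IsIntegrableOn (P : Codistribution E) (N : Set E) : Prop :=
  ∀ q ∈ N, ∃ N' ⊆ N, IsOpen N' ∧ q ∈ N' ∧
    ∃ (r : ℕ) (g : Fin r → E → ℝ), IsExactBasisOn g P N'

/-- The field `c` is Cauchy characteristic for `P` on `N`: `c ⌋ P = 0` and `c ⌋ dP ⊆ P`, tested on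
all smooth local sections `α` of `P`. -/
def IsCauchyCharacteristicOn (P : Codistribution E) (c : E → E) (N : Set E) : Prop :=
  ∀ N' ⊆ N, IsOpen N' → ∀ α : E → E →L[ℝ] ℝ, ContDiffOn ℝ ∞ α N' → (∀ q ∈ N', α q ∈ P q) →
    ∀ q ∈ N', α q (c q) = 0 ∧ contractExtDeriv α q (c q) ∈ P q

/-- The codistribution `P₀ = span(df¹, …, dfⁿ)`. -/
noncomputable def spanDifferentials {n : ℕ} (f : E → RVec n) : Codistribution E :=
  fun q => Submodule.span ℝ (Set.range fun i => fderiv ℝ (fun y => f y i) q)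

/-- The codistribution `P₁`: the covectors in `span(df)` annihilated by `W`. -/
noncomputable def reducedCodistribution {n : ℕ} (f : E → RVec n) (W : TangentDistribution E) :
    Codistribution E :=
  fun q =>
    { carrier := {α | α ∈ spanDifferentials f q ∧ ∀ w ∈ W q, α w = 0}
      zero_mem' := ⟨Submodule.zero_mem _, fun _ _ => rfl⟩
      add_mem' := fun {α β} hα hβ => ⟨Submodule.add_mem _ hα.1 hβ.1, fun w hw => by
        simp [hα.2 w hw, hβ.2 w hw]⟩
      smul_mem' := fun t α hα => ⟨Submodule.smul_mem _ t hα.1, fun w hw => by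
        simp [hα.2 w hw]⟩ }

/-- `P₁` is the largest codistribution `P` in `span(df)` with `W ⌋ P = 0`. -/
theorem isGreatest_reducedCodistribution {n : ℕ} (f : E → RVec n) (W : TangentDistribution E) :
    IsGreatest {P : Codistribution E |
      P ≤ spanDifferentials f ∧ ∀ q, ∀ α ∈ P q, ∀ w ∈ W q, α w = 0}
      (reducedCodistribution f W) :=
  ⟨⟨fun _ _ hα => hα.1, fun _ _ hα => hα.2⟩, fun _ hP q α hα => ⟨hP.1 q hα, hP.2 q α hα⟩⟩

/-- A homeomorphism between open sets that is smooth in both directions. -/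
def IsLocalDiffeo (t : OpenPartialHomeomorph E F) : Prop :=
  ContDiffOn ℝ ∞ t t.source ∧ ContDiffOn ℝ ∞ t.symm t.target

end General

section System

variable {n m : ℕ}

/-- The vertical tangent space `U = span(∂_{u¹}, …, ∂_{uᵐ})`. -/
def verticalSpace (n m : ℕ) : Submodule ℝ (RVec n × RVec m) := Submodule.prod ⊥ ⊤

/-- `W` is a `k`-dimensional subdistribution of `U` on `N` with a basis of vector fields that are
projectable by `f`. -/
def IsProjectableDistributionOn (f : RVec n × RVec m → RVec n)
    (W : TangentDistribution (RVec n × RVec m)) (k : ℕ) (N : Set (RVec n × RVec m)) : Prop :=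
  (∀ q ∈ N, W q ≤ verticalSpace n m) ∧
    ∃ w : Fin k → RVec n × RVec m → RVec n × RVec m,
      IsFrameOn w W N ∧ ∀ i, IsProjectableOn f (w i) N

/-- `W` is the Cauchy characteristic distribution of `P` inside `U`: on open subsets of `N`, the
smooth sections of `W` are exactly the vertical Cauchy characteristic fields of `P`. -/
def IsVerticalCauchyCharacteristicOn (W : TangentDistribution (RVec n × RVec m))
    (P : Codistribution (RVec n × RVec m)) (N : Set (RVec n × RVec m)) : Prop :=
  ∀ N' ⊆ N, IsOpen N' → ∀ c : RVec n × RVec m → RVec n × RVec m, ContDiffOn ℝ ∞ c N' →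
    ((∀ q ∈ N', c q ∈ W q) ↔
      ((∀ q ∈ N', c q ∈ verticalSpace n m) ∧ IsCauchyCharacteristicOn P c N'))

/-- `W` has a smooth regular involutive complement `V` in `U` on `N`. -/
def HasInvolutiveComplementOn (W : TangentDistribution (RVec n × RVec m))
    (N : Set (RVec n × RVec m)) : Prop :=
  ∃ (V : TangentDistribution (RVec n × RVec m)) (b : ℕ)
    (v : Fin b → RVec n × RVec m → RVec n × RVec m),
    IsFrameOn v V N ∧ IsInvolutiveOn V N ∧
      ∀ q ∈ N, Disjoint (V q) (W q) ∧ V q ⊔ W q = verticalSpace n m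

/-- Near `p` there is no projectable field in `U` outside `W`: each projectable vertical field
defined on some neighbourhood of `p` in `O` lies in `W` near `p`. -/
def NoProjectableOutside (f : RVec n × RVec m → RVec n) (O : Set (RVec n × RVec m))
    (p : RVec n × RVec m) (W : TangentDistribution (RVec n × RVec m)) : Prop :=
  ∀ N ⊆ O, IsOpen N → p ∈ N → ∀ v : RVec n × RVec m → RVec n × RVec m,
    (∀ q ∈ N, v q ∈ verticalSpace n m) → IsProjectableOn f v N → ∀ᶠ q in 𝓝 p, v q ∈ W q

/-- The dimensions of the subdistributions of `U` near `p` with a basis of projectable fields. -/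
def projectableDimensions (f : RVec n × RVec m → RVec n) (O : Set (RVec n × RVec m))
    (p : RVec n × RVec m) : Set ℕ :=
  {j | ∃ N ⊆ O, IsOpen N ∧ p ∈ N ∧ ∃ W, IsProjectableDistributionOn f W j N}

/-- The projectable vertical fields near `p` span a regular distribution. -/
def ProjectableFieldsRegular (f : RVec n × RVec m → RVec n) (O : Set (RVec n × RVec m))
    (p : RVec n × RVec m) : Prop :=
  ∃ N ⊆ O, IsOpen N ∧ p ∈ N ∧ ∃ (D : TangentDistribution (RVec n × RVec m)) (j : ℕ),
    IsProjectableDistributionOn f D j N ∧ NoProjectableOutside f O p D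

/-- The state transformation `x = h(z)`, `x₊ = h(z₊)` and the input transformation
`t : (x, u) ↦ (x, v, w)`, defined on a neighbourhood of `p` in `O`, bring `x₊ = f(x, u)` into the
form `z₊ = (G(z, v), v, w)`. The domain of `h` may be a disconnected open set, as the points `x` and
`f(x, u)` need not be close. -/
def IsNormalForm {a b k : ℕ} (f : RVec n × RVec m → RVec n) (O : Set (RVec n × RVec m))
    (p : RVec n × RVec m)
    (h : OpenPartialHomeomorph (RVec a × RVec b × RVec k) (RVec n))
    (t : OpenPartialHomeomorph (RVec n × RVec m) (RVec n × RVec b × RVec k))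
    (G : (RVec a × RVec b × RVec k) × RVec b → RVec a) : Prop :=
  IsLocalDiffeo h ∧ IsLocalDiffeo t ∧ p ∈ t.source ∧ t.source ⊆ O ∧
    (∀ q ∈ t.source, (t q).1 = q.1 ∧ q.1 ∈ h.target ∧ f q ∈ h.target) ∧
    ContDiffOn ℝ ∞ G ((fun q => (h.symm q.1, (t q).2.1)) '' t.source) ∧
    ∀ q ∈ t.source, h.symm (f q) = (G (h.symm q.1, (t q).2.1), (t q).2.1, (t q).2.2)

/-- Near `p` the system can be transformed to the normal form with `k` inputs `w`. -/
def HasNormalForm (f : RVec n × RVec m → RVec n) (O : Set (RVec n × RVec m))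
    (p : RVec n × RVec m) (k : ℕ) : Prop :=
  ∃ a b : ℕ, a + b + k = n ∧ b + k = m ∧
    ∃ (h : OpenPartialHomeomorph (RVec a × RVec b × RVec k) (RVec n))
      (t : OpenPartialHomeomorph (RVec n × RVec m) (RVec n × RVec b × RVec k))
      (G : (RVec a × RVec b × RVec k) × RVec b → RVec a), IsNormalForm f O p h t G

/-- The candidate new inputs `v = (g (inr j))ⱼ`, `w = (f^{τ i})ᵢ` as a map `(v, w) = q(x, u)`. -/
def newInputs {a b k : ℕ} (f : RVec n × RVec m → RVec n)
    (g : Fin a ⊕ Fin b → RVec n × RVec m → ℝ) (τ : Fin k → Fin n) :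
    RVec n × RVec m → RVec b × RVec k :=
  fun q => (fun j => g (Sum.inr j) q, fun i => f q (τ i))

/-- The functions are sorted so that the map `(v, w) = q(x, u)` is invertible with respect to `u`
near `p` (its partial derivative in `u` at `p` is invertible). -/
def IsSorted {a b k : ℕ} (f : RVec n × RVec m → RVec n)
    (g : Fin a ⊕ Fin b → RVec n × RVec m → ℝ) (τ : Fin k → Fin n) (p : RVec n × RVec m) : Prop :=
  Function.Bijective
    ((fderiv ℝ (newInputs f g τ) p).comp (ContinuousLinearMap.inr ℝ (RVec n) (RVec m)))

/-- The explicit construction of the transformation from `g¹, …, g^{a+b}` and `f^{τ 1}, …, f^{τ k}`,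
on a neighbourhood of `p` in `N`. The new inputs are `(v, w) = q(x, u)`; `W` becomes `span(∂_w)`;
the functions `g (inl i)` become functions `gHat` of `(x, v)`; `gHat` is completed to a local
diffeomorphism `z = p(x, v)` for fixed `v` (the map `pc` is `(x, v) ↦ (z, v)`); and the state
transformation `h` is given by `f(p⁻¹(z, v), q⁻¹(v, w)) = h(z¹, …, zᵃ, v, w)`. -/
def ConstructionYieldsNormalForm {a b k : ℕ} (f : RVec n × RVec m → RVec n)
    (N : Set (RVec n × RVec m)) (p : RVec n × RVec m) (W : TangentDistribution (RVec n × RVec m))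
    (g : Fin a ⊕ Fin b → RVec n × RVec m → ℝ) (τ : Fin k → Fin n) : Prop :=
  ∃ (h : OpenPartialHomeomorph (RVec a × RVec b × RVec k) (RVec n))
    (t : OpenPartialHomeomorph (RVec n × RVec m) (RVec n × RVec b × RVec k))
    (gHat : RVec n × RVec b → RVec a)
    (pc : OpenPartialHomeomorph (RVec n × RVec b) ((RVec a × RVec m) × RVec b)),
    IsNormalForm f N p h t (fun y => gHat (h y.1, y.2)) ∧
    (∀ q ∈ t.source, t q = (q.1, newInputs f g τ q)) ∧
    (∀ q ∈ t.source, W q =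
      Submodule.comap (fderiv ℝ t q).toLinearMap (Submodule.prod ⊥ (Submodule.prod ⊥ ⊤))) ∧
    ContDiffOn ℝ ∞ gHat ((fun q => (q.1, (t q).2.1)) '' t.source) ∧
    (∀ q ∈ t.source, ∀ i, gHat (q.1, (t q).2.1) i = g (Sum.inl i) q) ∧
    IsLocalDiffeo pc ∧ (p.1, (t p).2.1) ∈ pc.source ∧
    pc.source ⊆ (fun q => (q.1, (t q).2.1)) '' t.source ∧
    (∀ y ∈ pc.source, (pc y).1.1 = gHat y ∧ (pc y).2 = y.2) ∧
    ∀ z ∈ pc.target, ∀ w : RVec k, ((pc.symm z).1, z.2, w) ∈ t.target →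
      (z.1.1, z.2, w) ∈ h.source ∧
        f (t.symm ((pc.symm z).1, z.2, w)) = h (z.1.1, z.2, w)

end System

/-! ### Local diffeomorphisms and factorisation through submersions -/

section LocalDiffeo

variable {E F G : Type*} [NormedAddCommGroup E] [NormedSpace ℝ E]
  [NormedAddCommGroup F] [NormedSpace ℝ F] [NormedAddCommGroup G] [NormedSpace ℝ G]

/-! Everything turns on the integrability of `P₁`. Since `∂_u f` is injective, a vertical vector
killed by `P₁` already lies in `W`. So where `dg¹, …, dgʳ` is an exact basis of `P₁`, `W` is the
kernel of `d(x, g)` (`mem_iff_forall_fderiv_eq_zero`). Hence `W` is involutive, and by symmetry of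
second derivatives it is the Cauchy characteristic distribution of `P₁` within `U`.

From `W` to the normal form: `ker dg = ker df ⊕ W`, hence `r = n - k`. On vertical vectors the `dgⁱ`
have the `k`-dimensional common kernel `W`, so `m - k` of the `gⁱ`, called `v`, and `k` components
`w` of `f` are coordinates in `u` for fixed `x` (`exists_selection`). In these coordinates `W =
span(∂_w)` by dimension, so the remaining `gⁱ` are functions `ĝ(x, v)`. On the other hand, the
differentials of all `gⁱ` and of `w` lie in `span(df)`, so these functions factor through the
submersion `f` (`exists_smooth_factor`): `(ĝ, v, w) = s ∘ f`, where `s` is a local diffeomorphism of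
`ℝⁿ` by a dimension count. With `h = s⁻¹` this is the normal form, once `h` is extended so that its
image also covers `x₀` (`IsLocalDiffeo.exists_extend_source`). The complement is `V = span(∂_v)`.

Conversely, in the normal form a change of `w` with `x, v` fixed displaces `h⁻¹ ∘ f` by the same
vector. So `∂_w` projects to coordinate fields of `h`, and `P₁` is spanned by the differentials of
the first `n - k` components of `h⁻¹ ∘ f`.

Maximality is a comparison of dimensions. If no projectable field leaves `W`, every distribution
spanned by such fields lies in `W` near `p`; a normal form with `j` inputs `w` supplies one of
dimension `j`. If the projectable fields span a regular `D`, then `W ⊂ D` near `p`, and maximality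
of `k` forces equality. -/

theorem ContDiffOn.contDiffAt_of_isOpen {φ : E → F} {N : Set E} (hφ : ContDiffOn ℝ ∞ φ N)
    (hN : IsOpen N) {q : E} (hq : q ∈ N) : ContDiffAt ℝ ∞ φ q :=
  hφ.contDiffAt (hN.mem_nhds hq)

theorem ContDiffOn.differentiableAt_of_isOpen {φ : E → F} {N : Set E} (hφ : ContDiffOn ℝ ∞ φ N)
    (hN : IsOpen N) {q : E} (hq : q ∈ N) : DifferentiableAt ℝ φ q :=
  (hφ.contDiffAt_of_isOpen hN hq).differentiableAt (by simp)

theorem ContDiffOn.fderiv_infty {φ : E → F} {N : Set E} (hφ : ContDiffOn ℝ ∞ φ N)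
    (hN : IsOpen N) : ContDiffOn ℝ ∞ (fderiv ℝ φ) N :=
  hφ.fderiv_of_isOpen hN (by simp)

namespace IsLocalDiffeo

theorem symm {t : OpenPartialHomeomorph E F} (ht : IsLocalDiffeo t) : IsLocalDiffeo t.symm :=
  ⟨ht.2, ht.1⟩

theorem restrOpen {t : OpenPartialHomeomorph E F} (ht : IsLocalDiffeo t) {s : Set E}
    (hs : IsOpen s) : IsLocalDiffeo (t.restrOpen s hs) :=
  ⟨ht.1.mono (by simp), ht.2.mono (by
    rw [OpenPartialHomeomorph.restrOpen_toPartialEquiv]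
    exact fun y hy => hy.1)⟩

theorem differentiableAt {t : OpenPartialHomeomorph E F} (ht : IsLocalDiffeo t) {q : E}
    (hq : q ∈ t.source) : DifferentiableAt ℝ t q :=
  ht.1.differentiableAt_of_isOpen t.open_source hq

theorem fderiv_symm_comp {t : OpenPartialHomeomorph E F} (ht : IsLocalDiffeo t) {q : E}
    (hq : q ∈ t.source) :
    (fderiv ℝ t.symm (t q)).comp (fderiv ℝ t q) = ContinuousLinearMap.id ℝ E := by
  have h1 : HasFDerivAt t.symm (fderiv ℝ t.symm (t q)) (t q) :=
    (ht.symm.differentiableAt (t.map_source hq)).hasFDerivAt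
  have h2 := h1.comp q (ht.differentiableAt hq).hasFDerivAt
  exact h2.unique ((hasFDerivAt_id q).congr_of_eventuallyEq (t.eventually_left_inverse hq))

theorem fderiv_symm_apply {t : OpenPartialHomeomorph E F} (ht : IsLocalDiffeo t) {q : E}
    (hq : q ∈ t.source) (ξ : E) : fderiv ℝ t.symm (t q) (fderiv ℝ t q ξ) = ξ :=
  DFunLike.congr_fun (ht.fderiv_symm_comp hq) ξ

theorem fderiv_apply_symm {t : OpenPartialHomeomorph E F} (ht : IsLocalDiffeo t) {q : E}
    (hq : q ∈ t.source) (η : F) : fderiv ℝ t q (fderiv ℝ t.symm (t q) η) = η := by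
  have := ht.symm.fderiv_symm_apply (t.map_source hq) η
  rwa [t.left_inv hq] at this

theorem bijective_fderiv {t : OpenPartialHomeomorph E F} (ht : IsLocalDiffeo t) {q : E}
    (hq : q ∈ t.source) : Function.Bijective (fderiv ℝ t q) :=
  ⟨Function.LeftInverse.injective (ht.fderiv_symm_apply hq),
    Function.RightInverse.surjective (ht.fderiv_apply_symm hq)⟩

end IsLocalDiffeo

/-- The inverse function theorem for smooth maps, with smoothness of the inverse on a whole
neighbourhood. -/
theorem exists_isLocalDiffeo [FiniteDimensional ℝ E] [FiniteDimensional ℝ F] {φ : E → F}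
    {N : Set E} (hN : IsOpen N) (hφ : ContDiffOn ℝ ∞ φ N) {p : E} (hp : p ∈ N)
    (hb : Function.Bijective (fderiv ℝ φ p)) :
    ∃ t : OpenPartialHomeomorph E F,
      IsLocalDiffeo t ∧ p ∈ t.source ∧ t.source ⊆ N ∧ ∀ q, t q = φ q := by
  have : CompleteSpace E := FiniteDimensional.complete ℝ E
  have : CompleteSpace F := FiniteDimensional.complete ℝ F
  let e : E ≃L[ℝ] F := (LinearEquiv.ofBijective (fderiv ℝ φ p).toLinearMap hb).toContinuousLinearEquiv
  have he : HasFDerivAt φ (e : E →L[ℝ] F) p := (hφ.differentiableAt_of_isOpen hN hp).hasFDerivAt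
  have hc := hφ.contDiffAt_of_isOpen hN hp
  let t₀ := hc.toOpenPartialHomeomorph φ he (by simp)
  -- Restricting to the points where `dφ` is invertible makes the inverse smooth on the whole
  -- target, not only at the image of `p`.
  have hM : IsOpen (N ∩ fderiv ℝ φ ⁻¹' Set.range ((↑) : (E ≃L[ℝ] F) → E →L[ℝ] F)) :=
    (hφ.fderiv_infty hN).continuousOn.isOpen_inter_preimage hN ContinuousLinearEquiv.isOpen
  have hp₀ : p ∈ t₀.source := hc.mem_toOpenPartialHomeomorph_source he (by simp)
  refine ⟨t₀.restrOpen _ hM, ⟨?_, ?_⟩, ⟨hp₀, hp, e, he.fderiv.symm⟩, fun q hq => hq.2.1,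
    fun q => rfl⟩
  · exact hφ.mono fun q hq => hq.2.1
  · intro y hy
    have hy' := (t₀.restrOpen _ hM).map_target hy
    obtain ⟨e', he'⟩ := hy'.2.2
    refine ContDiffAt.contDiffWithinAt ?_
    refine (t₀.restrOpen _ hM).contDiffAt_symm (f₀' := e') hy ?_
      (hφ.contDiffAt_of_isOpen hN hy'.2.1)
    rw [he']
    exact (hφ.differentiableAt_of_isOpen hN hy'.2.1).hasFDerivAt

/-- A smooth map whose differential vanishes on the kernel of the differential of a submersion
factors locally through the submersion. -/
theorem exists_smooth_factor [FiniteDimensional ℝ E] [FiniteDimensional ℝ F] {φ : E → F}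
    {g : E → G} {N : Set E} (hN : IsOpen N) (hφ : ContDiffOn ℝ ∞ φ N) (hg : ContDiffOn ℝ ∞ g N)
    {p : E} (hp : p ∈ N) (hs : Function.Surjective (fderiv ℝ φ p))
    (hker : ∀ q ∈ N, ∀ ξ, fderiv ℝ φ q ξ = 0 → fderiv ℝ g q ξ = 0) :
    ∃ N' ⊆ N, IsOpen N' ∧ p ∈ N' ∧ IsOpen (φ '' N') ∧
      ∃ γ : F → G, ContDiffOn ℝ ∞ γ (φ '' N') ∧ ∀ q ∈ N', g q = γ (φ q) := by
  obtain ⟨π, hπ⟩ := (fderiv ℝ φ p).ker_closedComplemented_of_finiteDimensional_range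
  let K := (fderiv ℝ φ p).ker
  have hΦd : ∀ q ∈ N, HasFDerivAt (fun q => (φ q, π q)) ((fderiv ℝ φ q).prod π) q := fun q hq =>
    (hφ.differentiableAt_of_isOpen hN hq).hasFDerivAt.prodMk π.hasFDerivAt
  have hb : Function.Bijective (fderiv ℝ (fun q => (φ q, π q)) p) := by
    rw [(hΦd p hp).fderiv]
    refine ⟨(injective_iff_map_eq_zero _).2 fun ξ hξ => ?_, fun η => ?_⟩
    · have h1 : fderiv ℝ φ p ξ = 0 := congrArg Prod.fst hξ
      have h2 : π ξ = 0 := congrArg Prod.snd hξ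
      have h3 := hπ ⟨ξ, h1⟩
      rw [h2] at h3
      exact (congrArg Subtype.val h3).symm
    · obtain ⟨ξ, hξ⟩ := hs η.1
      -- A correction by a vector of the kernel adjusts the `π`-component without changing the image
      -- under `dφ`.
      refine ⟨ξ + ((η.2 - π ξ : K) : E), Prod.ext ?_ ?_⟩
      · have : fderiv ℝ φ p ((η.2 - π ξ : K) : E) = 0 := (η.2 - π ξ : K).2
        simp [hξ]
      · have := hπ (η.2 - π ξ)
        simp only [ContinuousLinearMap.prod_apply, map_add, this, Prod.snd_add]
        abel
  obtain ⟨s, hsd, hps, hsN, hsφ⟩ := exists_isLocalDiffeo hN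
    (hφ.prodMk π.contDiff.contDiffOn) hp hb
  have hsp : (φ p, π p) ∈ s.target := hsφ p ▸ s.map_source hps
  -- A product of balls in the target makes the fibres of `φ` connected and the image of `φ` an open
  -- ball.
  obtain ⟨r, hr, hball⟩ := Metric.isOpen_iff.1 s.open_target _ hsp
  rw [← ball_prod_same] at hball
  have hB : IsOpen (Metric.ball (φ p) r ×ˢ Metric.ball (π p) r) :=
    Metric.isOpen_ball.prod Metric.isOpen_ball
  have himage : φ '' (s.source ∩ s ⁻¹' (Metric.ball (φ p) r ×ˢ Metric.ball (π p) r)) =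
      Metric.ball (φ p) r := by
    ext y
    constructor
    · rintro ⟨q, ⟨-, hq⟩, rfl⟩
      rw [Set.mem_preimage, hsφ] at hq
      exact hq.1
    · intro hy
      have hm : (y, π p) ∈ Metric.ball (φ p) r ×ˢ Metric.ball (π p) r :=
        ⟨hy, Metric.mem_ball_self hr⟩
      refine ⟨s.symm (y, π p), ⟨s.map_target (hball hm), ?_⟩, ?_⟩
      · rw [Set.mem_preimage, s.right_inv (hball hm)]
        exact hm
      · have := s.right_inv (hball hm)
        rw [hsφ] at this
        exact congrArg Prod.fst this
  refine ⟨s.source ∩ s ⁻¹' (Metric.ball (φ p) r ×ˢ Metric.ball (π p) r),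
    fun q hq => hsN hq.1, s.isOpen_inter_preimage hB, ⟨hps, ?_⟩, ?_,
    fun y => g (s.symm (y, π p)), ?_, ?_⟩
  · rw [Set.mem_preimage, hsφ]
    exact ⟨Metric.mem_ball_self hr, Metric.mem_ball_self hr⟩
  · rw [himage]
    exact Metric.isOpen_ball
  · rw [himage]
    refine hg.comp (hsd.2.comp (contDiff_id.prodMk contDiff_const).contDiffOn
      fun y hy => ?_) fun y hy => hsN (s.map_target ?_)
    · exact hball ⟨hy, Metric.mem_ball_self hr⟩
    · exact hball ⟨hy, Metric.mem_ball_self hr⟩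
  · rintro q ⟨hq, hqB⟩
    rw [Set.mem_preimage, hsφ] at hqB
    have hmem : ∀ κ ∈ Metric.ball (π p) r, (φ q, κ) ∈ s.target := fun κ hκ => hball ⟨hqB.1, hκ⟩
    -- Moving `κ` with `φ` fixed moves the preimage along `ker dφ`, where `dg` vanishes; so `g` is
    -- constant on each fibre and may be evaluated on the slice `π = π p`.
    have hd : ∀ κ ∈ Metric.ball (π p) r,
        HasFDerivAt (fun κ => g (s.symm (φ q, κ))) (0 : K →L[ℝ] G) κ := by
      intro κ hκ
      have hz := s.map_target (hmem κ hκ)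
      have h1 : HasFDerivAt (fun κ : K => (φ q, κ)) (ContinuousLinearMap.inr ℝ F K) κ :=
        hasFDerivAt_prodMk_right (φ q) κ
      have h2 : HasFDerivAt s.symm (fderiv ℝ s.symm (φ q, κ)) (φ q, κ) :=
        (hsd.symm.differentiableAt (hmem κ hκ)).hasFDerivAt
      have h3 := (hg.differentiableAt_of_isOpen hN (hsN hz)).hasFDerivAt
      refine (h3.comp κ (h2.comp κ h1)).congr_fderiv ?_
      ext δ
      refine hker _ (hsN hz) _ ?_
      have h4 := hsd.symm.fderiv_symm_apply (hmem κ hκ) (0, δ)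
      have h5 : fderiv ℝ s (s.symm (φ q, κ)) = (fderiv ℝ φ (s.symm (φ q, κ))).prod π := by
        rw [show (s : E → F × K) = fun q => (φ q, π q) from funext hsφ]
        exact (hΦd _ (hsN hz)).fderiv
      rw [OpenPartialHomeomorph.symm_symm, h5] at h4
      exact congrArg Prod.fst h4
    have h6 := Metric.isOpen_ball.is_const_of_fderiv_eq_zero (𝕜 := ℝ)
      (convex_ball (π p) r).isPreconnected
      (fun κ hκ => (hd κ hκ).differentiableAt.differentiableWithinAt)
      (fun κ hκ => (hd κ hκ).fderiv) hqB.2 (Metric.mem_ball_self hr)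
    have h7 : s.symm (φ q, π q) = q := by rw [← hsφ q, s.left_inv hq]
    simp only [h7] at h6
    exact h6

end LocalDiffeo

/-! ### Involutivity, spans of covectors, exterior derivatives -/

section Distribution

theorem minSmoothness_two_le_infty : minSmoothness ℝ 2 ≤ ∞ := by
  rw [minSmoothness_of_isRCLikeNormedField]
  exact WithTop.coe_le_coe.2 (le_top : (2 : ℕ∞) ≤ ⊤)

variable {E F : Type*} [NormedAddCommGroup E] [NormedSpace ℝ E]
  [NormedAddCommGroup F] [NormedSpace ℝ F]

/-- The kernel of the differential of a smooth map is an involutive distribution. -/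
theorem isInvolutiveOn_of_mem_iff_fderiv_eq_zero {φ : E → F} {N : Set E} (hN : IsOpen N)
    (hφ : ContDiffOn ℝ ∞ φ N) {D : TangentDistribution E}
    (hD : ∀ q ∈ N, ∀ ξ, ξ ∈ D q ↔ fderiv ℝ φ q ξ = 0) : IsInvolutiveOn D N := by
  intro N' hN'N hN' a b ha hb haD hbD q hq
  -- For a section `c` the function `dφ(c)` vanishes identically. The bracket identity expresses
  -- `dφ([a, b])` by derivatives of `dφ(a)` and `dφ(b)`.
  have hz : ∀ c : E → E, (∀ q ∈ N', c q ∈ D q) →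
      fderiv ℝ (fun y => fderiv ℝ φ y (c y)) q = 0 := by
    intro c hc
    have : (fun y => fderiv ℝ φ y (c y)) =ᶠ[𝓝 q] fun _ => 0 := by
      filter_upwards [hN'.mem_nhds hq] with y hy
      exact (hD y (hN'N hy) _).1 (hc y hy)
    rw [this.fderiv_eq]
    simp
  rw [hD q (hN'N hq), VectorField.fderiv_apply_lieBracket
    (hφ.contDiffAt_of_isOpen hN (hN'N hq)) minSmoothness_two_le_infty
    (hb.differentiableAt_of_isOpen hN' hq) (ha.differentiableAt_of_isOpen hN' hq), hz a haD,
    hz b hbD]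
  simp

theorem isInvolutiveOn_of_locally {D : TangentDistribution E} {N : Set E}
    (h : ∀ q ∈ N, ∃ N', IsOpen N' ∧ q ∈ N' ∧ IsInvolutiveOn D N') : IsInvolutiveOn D N := by
  intro M hMN hM a b ha hb haD hbD q hq
  obtain ⟨N', hN', hqN', hinv⟩ := h q (hMN hq)
  exact hinv (M ∩ N') Set.inter_subset_right (hM.inter hN') a b
    (ha.mono Set.inter_subset_left) (hb.mono Set.inter_subset_left)
    (fun y hy => haD y hy.1) (fun y hy => hbD y hy.1) q ⟨hq, hqN'⟩

/-- A continuous functional is in the span of finitely many others iff it vanishes on their common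
kernel. -/
theorem ContinuousLinearMap.mem_span_range_iff {ι : Type*} [Finite ι] (L : ι → E →L[ℝ] ℝ)
    (α : E →L[ℝ] ℝ) :
    α ∈ Submodule.span ℝ (Set.range L) ↔ ∀ ξ, (∀ i, L i ξ = 0) → α ξ = 0 := by
  constructor
  · intro h ξ hξ
    have : Submodule.span ℝ (Set.range L) ≤
        LinearMap.ker (ContinuousLinearMap.apply ℝ ℝ ξ).toLinearMap :=
      Submodule.span_le.2 (by rintro _ ⟨i, rfl⟩; exact hξ i)
    exact this h
  · intro h
    have h1 := mem_span_of_iInf_ker_le_ker (L := fun i => (L i).toLinearMap)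
      (K := α.toLinearMap) (fun ξ hξ => h ξ fun i => by
        simpa using (Submodule.mem_iInf _).1 hξ i)
    have h2 : Set.range (fun i => (L i).toLinearMap) =
        (ContinuousLinearMap.coeLM ℝ : (E →L[ℝ] ℝ) →ₗ[ℝ] E →ₗ[ℝ] ℝ) '' Set.range L := by
      rw [← Set.range_comp]; rfl
    rw [h2, ← Submodule.map_span] at h1
    obtain ⟨β, hβ, hβα⟩ := h1
    have : β = α := ContinuousLinearMap.coe_injective hβα
    exact this ▸ hβ

/-- A proper range in `ℝ^ι` is killed by a nonzero functional, whose values on the standard basis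
are the coefficients of a linear dependence. -/
theorem ContinuousLinearMap.surjective_pi_iff_linearIndependent {ι : Type*} [Fintype ι]
    (L : ι → E →L[ℝ] ℝ) :
    Function.Surjective (fun ξ i => L i ξ) ↔ LinearIndependent ℝ L := by
  classical
  rw [Fintype.linearIndependent_iff]
  constructor
  · intro h c hc i
    obtain ⟨ξ, hξ⟩ := h (Pi.single i 1)
    have h1 := DFunLike.congr_fun hc ξ
    have h2 : ∀ j, L j ξ = (Pi.single i 1 : ι → ℝ) j := congrFun hξ
    simpa [h2, Pi.single_apply] using h1
  · intro h
    let Λ : E →ₗ[ℝ] ι → ℝ := LinearMap.pi fun i => (L i).toLinearMap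
    change Function.Surjective Λ
    rw [← LinearMap.range_eq_top]
    by_contra hne
    obtain ⟨μ, hμ, hle⟩ := Submodule.exists_le_ker_of_lt_top _ (lt_top_iff_ne_top.2 hne)
    refine hμ (LinearMap.pi_ext' fun i => LinearMap.ext_ring ?_)
    refine h (fun i => μ (Pi.single i 1)) (ContinuousLinearMap.ext fun ξ => ?_) i
    have h1 : μ (Λ ξ) = 0 := hle ⟨ξ, rfl⟩
    rw [LinearMap.pi_apply_eq_sum_univ μ (Λ ξ)] at h1
    simp only [FunLike.coe_sum, Finset.sum_apply, FunLike.coe_smul,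
      Pi.smul_apply, smul_eq_mul, zero_apply]
    rw [← h1]
    refine Finset.sum_congr rfl fun j _ => ?_
    rw [smul_eq_mul, mul_comm]
    congr 2
    ext l
    simp [Pi.single_apply, eq_comm]

/-- A one-form that vanishes on the fibres of a submersion has an exterior derivative whose
contraction with a vertical vector vanishes on vertical vectors. -/
theorem contractExtDeriv_eq_zero [FiniteDimensional ℝ F] {φ : E → F} {N : Set E} (hN : IsOpen N)
    (hφ : ContDiffOn ℝ ∞ φ N) {α : E → E →L[ℝ] ℝ} (hα : ContDiffOn ℝ ∞ α N)
    (hker : ∀ q ∈ N, ∀ ξ, fderiv ℝ φ q ξ = 0 → α q ξ = 0) {q : E} (hq : q ∈ N)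
    (hs : Function.Surjective (fderiv ℝ φ q)) {b c : E} (hb : fderiv ℝ φ q b = 0)
    (hc : fderiv ℝ φ q c = 0) : contractExtDeriv α q c b = 0 := by
  have : CompleteSpace F := FiniteDimensional.complete ℝ F
  obtain ⟨S₀, hS₀⟩ := (fderiv ℝ φ q).toLinearMap.exists_rightInverse_of_surjective
    (LinearMap.range_eq_top.2 hs)
  let S : F →L[ℝ] E := LinearMap.toContinuousLinearMap S₀
  have hSq : (fderiv ℝ φ q).comp S = ContinuousLinearMap.id ℝ F := by
    ext y
    exact DFunLike.congr_fun hS₀ y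
  have hφ' : DifferentiableAt ℝ (fderiv ℝ φ) q :=
    (hφ.fderiv_infty hN).differentiableAt_of_isOpen hN hq
  have hA : DifferentiableAt ℝ (fun y => (fderiv ℝ φ y).comp S) q :=
    hφ'.clm_comp (differentiableAt_const S)
  have hI : DifferentiableAt ℝ (fun y => ((fderiv ℝ φ y).comp S).inverse) q := by
    have h1 : DifferentiableAt ℝ ContinuousLinearMap.inverse ((fderiv ℝ φ q).comp S) := by
      rw [hSq]
      exact (contDiffAt_map_inverse (n := 1) (ContinuousLinearEquiv.refl ℝ F)).differentiableAt
        (by simp)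
    exact h1.comp q hA
  have hαd := hα.differentiableAt_of_isOpen hN hq
  -- A fixed right inverse `S` of `dφ` at `q` yields the right inverse `S (dφ S)⁻¹` at nearby
  -- points. Since `α` kills `ker dφ`, this gives `α = β ∘ dφ` with `β` differentiable.
  let β : E → F →L[ℝ] ℝ := fun y => (α y).comp (S.comp ((fderiv ℝ φ y).comp S).inverse)
  have hβ : DifferentiableAt ℝ β q := hαd.clm_comp ((differentiableAt_const S).clm_comp hI)
  have hev : α =ᶠ[𝓝 q] fun y => (β y).comp (fderiv ℝ φ y) := by
    have h1 : ∀ᶠ y in 𝓝 q, (fderiv ℝ φ y).comp S ∈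
        Set.range ((↑) : (F ≃L[ℝ] F) → F →L[ℝ] F) := by
      refine hA.continuousAt.eventually_mem (ContinuousLinearEquiv.isOpen.mem_nhds ?_)
      exact ⟨ContinuousLinearEquiv.refl ℝ F, hSq.symm⟩
    filter_upwards [h1, hN.mem_nhds hq] with y hy hyN
    obtain ⟨e, he⟩ := hy
    ext ξ
    have h2 : fderiv ℝ φ y (ξ - S (e.symm (fderiv ℝ φ y ξ))) = 0 := by
      have h3 := DFunLike.congr_fun he (e.symm (fderiv ℝ φ y ξ))
      simp only [ContinuousLinearEquiv.coe_coe, ContinuousLinearEquiv.apply_symm_apply,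
        ContinuousLinearMap.comp_apply] at h3
      rw [map_sub, ← h3, sub_self]
    have h4 := hker y hyN _ h2
    rw [map_sub, sub_eq_zero] at h4
    simp only [β, ← he, ContinuousLinearMap.inverse_equiv, ContinuousLinearMap.comp_apply]
    exact h4
  -- The term with the derivative of `β` drops out because it is applied to `dφ(y) = 0`; what
  -- remains is symmetric when both vectors are vertical.
  have hd : ∀ x y : E, fderiv ℝ φ q y = 0 →
      fderiv ℝ α q x y = β q (fderiv ℝ (fderiv ℝ φ) q x y) := by
    intro x y hy
    rw [hev.fderiv_eq, fderiv_clm_comp hβ hφ']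
    simp [hy]
  have hsymm := (hφ.contDiffAt_of_isOpen hN hq).isSymmSndFDerivAt minSmoothness_two_le_infty
  simp only [contractExtDeriv, sub_apply, ContinuousLinearMap.flip_apply]
  rw [hd c b hb, hd b c hc, hsymm b c, sub_self]

end Distribution

/-! ### Codistributions with an exact basis -/

section ExactBasis

variable {E : Type*} [NormedAddCommGroup E] [NormedSpace ℝ E]

theorem fderiv_component {n : ℕ} {f : E → RVec n} {q : E} (hf : DifferentiableAt ℝ f q)
    (i : Fin n) (ξ : E) : fderiv ℝ (fun y => f y i) q ξ = fderiv ℝ f q ξ i := by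
  rw [(hasFDerivAt_pi'.1 hf.hasFDerivAt i).fderiv]
  rfl

theorem mem_spanDifferentials_iff {n : ℕ} {f : E → RVec n} {q : E} (hf : DifferentiableAt ℝ f q)
    (α : E →L[ℝ] ℝ) :
    α ∈ spanDifferentials f q ↔ ∀ ξ, fderiv ℝ f q ξ = 0 → α ξ = 0 := by
  refine (ContinuousLinearMap.mem_span_range_iff _ α).trans (forall_congr' fun ξ => ?_)
  simp only [fderiv_component hf, funext_iff, Pi.zero_apply]

namespace IsExactBasisOn

variable {ι κ : Type*} {g : ι → E → ℝ} {P : Codistribution E} {N N' : Set E}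

theorem mono (h : IsExactBasisOn g P N) (hN : N' ⊆ N) : IsExactBasisOn g P N' :=
  ⟨fun i => (h.1 i).mono hN, fun q hq => h.2 q (hN hq)⟩

theorem reindex (h : IsExactBasisOn g P N) (e : κ ≃ ι) :
    IsExactBasisOn (fun i => g (e i)) P N := by
  refine ⟨fun i => h.1 (e i), fun q hq => ⟨(h.2 q hq).1.comp e e.injective, ?_⟩⟩
  rw [(h.2 q hq).2]
  exact congrArg _ (e.surjective.range_comp fun i => fderiv ℝ (g i) q).symm

theorem mem_iff [Finite ι] (h : IsExactBasisOn g P N) {q : E} (hq : q ∈ N) (α : E →L[ℝ] ℝ) :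
    α ∈ P q ↔ ∀ ξ, (∀ i, fderiv ℝ (g i) q ξ = 0) → α ξ = 0 := by
  rw [(h.2 q hq).2, ContinuousLinearMap.mem_span_range_iff]

theorem fderiv_mem (h : IsExactBasisOn g P N) {q : E} (hq : q ∈ N) (i : ι) :
    fderiv ℝ (g i) q ∈ P q := by
  rw [(h.2 q hq).2]
  exact Submodule.subset_span ⟨i, rfl⟩

theorem surjective [Fintype ι] (h : IsExactBasisOn g P N) {q : E} (hq : q ∈ N) :
    Function.Surjective (fun ξ i => fderiv ℝ (g i) q ξ) :=
  (ContinuousLinearMap.surjective_pi_iff_linearIndependent _).2 (h.2 q hq).1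

theorem of_mem_iff [Fintype ι] (hg : ∀ i, ContDiffOn ℝ ∞ (g i) N)
    (hs : ∀ q ∈ N, Function.Surjective (fun ξ i => fderiv ℝ (g i) q ξ))
    (hP : ∀ q ∈ N, ∀ α, α ∈ P q ↔ ∀ ξ, (∀ i, fderiv ℝ (g i) q ξ = 0) → α ξ = 0) :
    IsExactBasisOn g P N := by
  refine ⟨hg, fun q hq =>
    ⟨(ContinuousLinearMap.surjective_pi_iff_linearIndependent _).1 (hs q hq), ?_⟩⟩
  ext α
  rw [hP q hq, ContinuousLinearMap.mem_span_range_iff]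

theorem isIntegrableOn [Fintype ι] (h : IsExactBasisOn g P N) (hN : IsOpen N) :
    IsIntegrableOn P N := fun _ hq =>
  ⟨N, subset_rfl, hN, hq, _, _, h.reindex (Fintype.equivFin ι).symm⟩

/-- The functions of an exact basis assembled to one smooth map. -/
theorem hasFDerivAt_pi [Fintype ι] (h : IsExactBasisOn g P N) (hN : IsOpen N) {q : E}
    (hq : q ∈ N) :
    HasFDerivAt (fun y i => g i y) (ContinuousLinearMap.pi fun i => fderiv ℝ (g i) q) q :=
  _root_.hasFDerivAt_pi.2 fun i => ((h.1 i).differentiableAt_of_isOpen hN hq).hasFDerivAt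

theorem contDiffOn_pi [Fintype ι] (h : IsExactBasisOn g P N) :
    ContDiffOn ℝ ∞ (fun y i => g i y) N := _root_.contDiffOn_pi.2 h.1

/-- A section of the annihilator of an integrable codistribution is Cauchy characteristic. -/
theorem contractExtDeriv_mem [Fintype ι] (h : IsExactBasisOn g P N) (hN : IsOpen N)
    {α : E → E →L[ℝ] ℝ} (hα : ContDiffOn ℝ ∞ α N) (hαP : ∀ q ∈ N, α q ∈ P q) {q : E}
    (hq : q ∈ N) {c : E} (hc : ∀ β ∈ P q, β c = 0) : contractExtDeriv α q c ∈ P q := by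
  have hd : ∀ y ∈ N, ∀ ξ, fderiv ℝ (fun y i => g i y) y ξ = 0 ↔ ∀ i, fderiv ℝ (g i) y ξ = 0 := by
    intro y hy ξ
    rw [(h.hasFDerivAt_pi hN hy).fderiv, funext_iff]
    rfl
  refine (h.mem_iff hq _).2 fun b hb => ?_
  refine contractExtDeriv_eq_zero hN h.contDiffOn_pi hα
    (fun y hy ξ hξ => (h.mem_iff hy _).1 (hαP y hy) ξ ((hd y hy ξ).1 hξ)) hq ?_
    ((hd q hq b).2 hb) ((hd q hq c).2 fun i => hc _ (h.fderiv_mem hq i))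
  rw [(h.hasFDerivAt_pi hN hq).fderiv]
  exact h.surjective hq

end IsExactBasisOn

end ExactBasis

/-! ### Consequences of the integrability of `P₁` -/

section Cauchy

variable {n m : ℕ} {f : RVec n × RVec m → RVec n}
  {W : TangentDistribution (RVec n × RVec m)} {N : Set (RVec n × RVec m)}

theorem mem_verticalSpace {c : RVec n × RVec m} : c ∈ verticalSpace n m ↔ c.1 = 0 := by
  simp [verticalSpace, Submodule.mem_prod]

/-- A vertical vector annihilated by `P₁` lies in `W`, if `∂_u f` is injective. -/
theorem mem_of_forall_reducedCodistribution {q : RVec n × RVec m} (hf : DifferentiableAt ℝ f q)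
    (hinj : ∀ c ∈ verticalSpace n m, fderiv ℝ f q c = 0 → c = 0)
    (hW : W q ≤ verticalSpace n m) {c : RVec n × RVec m} (hc : c ∈ verticalSpace n m)
    (h : ∀ α ∈ reducedCodistribution f W q, α c = 0) : c ∈ W q := by
  have h1 : fderiv ℝ f q c ∈ (W q).map (fderiv ℝ f q).toLinearMap := by
    -- A functional separating `df(c)` from `df(W)`, composed with `df`, would be an element of `P₁`
    -- that does not kill `c`.
    by_contra hne
    obtain ⟨μ, hμ, hle⟩ := Submodule.exists_le_ker_of_notMem hne
    refine hμ (h ((LinearMap.toContinuousLinearMap μ).comp (fderiv ℝ f q)) ⟨?_, fun w hw => ?_⟩)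
    · rw [mem_spanDifferentials_iff hf]
      intro ξ hξ
      simp [hξ]
    · exact hle (Submodule.mem_map_of_mem hw)
  obtain ⟨w, hw, hwc⟩ := h1
  have h2 : c - w = 0 := hinj _ (Submodule.sub_mem _ hc (hW hw)) (by
    rw [map_sub, sub_eq_zero]
    exact hwc.symm)
  rw [sub_eq_zero.1 h2]
  exact hw

/-- This presents `W` as the kernel of `d(x, g)`, the form needed for involutivity, for the Cauchy
characteristic property and for the choice of new inputs. -/
theorem mem_iff_forall_fderiv_eq_zero {ι : Type*} [Fintype ι] {g : ι → RVec n × RVec m → ℝ}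
    (hg : IsExactBasisOn g (reducedCodistribution f W) N) {q : RVec n × RVec m} (hq : q ∈ N)
    (hf : DifferentiableAt ℝ f q)
    (hinj : ∀ c ∈ verticalSpace n m, fderiv ℝ f q c = 0 → c = 0)
    (hW : W q ≤ verticalSpace n m) (c : RVec n × RVec m) :
    c ∈ W q ↔ c.1 = 0 ∧ ∀ i, fderiv ℝ (g i) q c = 0 := by
  constructor
  · intro hc
    exact ⟨mem_verticalSpace.1 (hW hc), fun i => (hg.fderiv_mem hq i).2 c hc⟩
  · rintro ⟨h1, h2⟩
    exact mem_of_forall_reducedCodistribution hf hinj hW (mem_verticalSpace.2 h1)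
      fun α hα => (hg.mem_iff hq α).1 hα c h2

/-- If `P₁` is integrable, then `W` is its Cauchy characteristic distribution within `U`. -/
theorem isVerticalCauchyCharacteristicOn_of_isIntegrableOn
    (hf : ∀ q ∈ N, DifferentiableAt ℝ f q)
    (hinj : ∀ q ∈ N, ∀ c ∈ verticalSpace n m, fderiv ℝ f q c = 0 → c = 0)
    (hW : ∀ q ∈ N, W q ≤ verticalSpace n m)
    (hP : IsIntegrableOn (reducedCodistribution f W) N) :
    IsVerticalCauchyCharacteristicOn W (reducedCodistribution f W) N := by
  intro M hMN hM c _
  constructor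
  · refine fun hc => ⟨fun q hq => hW q (hMN hq) (hc q hq), fun M' hM' hM'o α hα hαP q hq => ?_⟩
    have hcq : ∀ β ∈ reducedCodistribution f W q, β (c q) = 0 := fun β hβ =>
      hβ.2 _ (hc q (hM' hq))
    obtain ⟨N₁, -, hN₁o, hqN₁, r, g, hg⟩ := hP q (hMN (hM' hq))
    exact ⟨hcq _ (hαP q hq), (hg.mono Set.inter_subset_right).contractExtDeriv_mem
      (hM'o.inter hN₁o) (hα.mono Set.inter_subset_left) (fun y hy => hαP y hy.1) ⟨hq, hqN₁⟩ hcq⟩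
  · rintro ⟨hcU, hcC⟩ q hq
    obtain ⟨N₁, -, hN₁o, hqN₁, r, g, hg⟩ := hP q (hMN hq)
    refine (mem_iff_forall_fderiv_eq_zero hg hqN₁ (hf q (hMN hq)) (hinj q (hMN hq))
      (hW q (hMN hq)) _).2 ⟨mem_verticalSpace.1 (hcU q hq), fun i => ?_⟩
    exact (hcC (M ∩ N₁) Set.inter_subset_left (hM.inter hN₁o) (fderiv ℝ (g i))
      (((hg.1 i).fderiv_infty hN₁o).mono Set.inter_subset_right)
      (fun y hy => hg.fderiv_mem hy.2 i) q ⟨hq, hqN₁⟩).1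

/-- If `P₁` is integrable, then `W` is involutive. -/
theorem isInvolutiveOn_of_isIntegrableOn_reducedCodistribution
    (hf : ∀ q ∈ N, DifferentiableAt ℝ f q)
    (hinj : ∀ q ∈ N, ∀ c ∈ verticalSpace n m, fderiv ℝ f q c = 0 → c = 0)
    (hW : ∀ q ∈ N, W q ≤ verticalSpace n m)
    (hP : IsIntegrableOn (reducedCodistribution f W) N) : IsInvolutiveOn W N := by
  refine isInvolutiveOn_of_locally fun q hq => ?_
  obtain ⟨N₁, hN₁N, hN₁o, hqN₁, r, g, hg⟩ := hP q hq
  refine ⟨N₁, hN₁o, hqN₁, isInvolutiveOn_of_mem_iff_fderiv_eq_zero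
    (φ := fun y => (y.1, fun i => g i y)) hN₁o (contDiffOn_fst.prodMk hg.contDiffOn_pi)
    fun y hy ξ => ?_⟩
  rw [mem_iff_forall_fderiv_eq_zero hg hy (hf y (hN₁N hy)) (hinj y (hN₁N hy)) (hW y (hN₁N hy)),
    (hasFDerivAt_fst.prodMk (hg.hasFDerivAt_pi hN₁o hy)).fderiv]
  simp [Prod.ext_iff, funext_iff]

end Cauchy

/-! ### From the normal form to the distribution `span(∂_w)` -/

section NormalForm

variable {E F : Type*} [NormedAddCommGroup E] [NormedSpace ℝ E]
  [NormedAddCommGroup F] [NormedSpace ℝ F]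

/-- The pull-back of a constant distribution by a local diffeomorphism. -/
theorem IsLocalDiffeo.isFrameOn_comap_range {k : ℕ} {t : OpenPartialHomeomorph E F}
    (ht : IsLocalDiffeo t) (ι : RVec k →L[ℝ] F) (hι : Function.Injective ι) :
    IsFrameOn (fun i q => fderiv ℝ t.symm (t q) (ι (Pi.single i 1)))
      (fun q => (LinearMap.range ι.toLinearMap).comap (fderiv ℝ t q).toLinearMap) t.source := by
  refine ⟨fun i => ?_, fun q hq => ?_⟩
  · refine ContDiffOn.clm_apply ?_ contDiffOn_const
    exact (ht.2.fderiv_infty t.open_target).comp ht.1 fun q hq => t.map_source hq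
  · let L : RVec k →ₗ[ℝ] E := (fderiv ℝ t.symm (t q)).toLinearMap ∘ₗ ι.toLinearMap
    have hL : Function.Injective L := by
      have h1 : Function.Injective (fderiv ℝ t.symm (t q)) :=
        (ht.symm.bijective_fderiv (t.map_source hq)).1
      exact h1.comp hι
    have hb : LinearIndependent ℝ (fun i => L (Pi.basisFun ℝ (Fin k) i)) :=
      (Pi.basisFun ℝ (Fin k)).linearIndependent.map' L (LinearMap.ker_eq_bot.2 hL)
    have hr : Set.range (fun i => L (Pi.basisFun ℝ (Fin k) i)) =
        L '' Set.range (Pi.basisFun ℝ (Fin k)) := by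
      rw [← Set.range_comp]; rfl
    have hspan : Submodule.span ℝ (Set.range fun i => L (Pi.basisFun ℝ (Fin k) i)) =
        LinearMap.range L := by
      rw [hr, ← Submodule.map_span, (Pi.basisFun ℝ (Fin k)).span_eq, Submodule.map_top]
    simp only [Pi.basisFun_apply] at hb hspan
    refine ⟨hb, Eq.trans ?_ hspan.symm⟩
    ext ξ
    constructor
    · rintro ⟨y, hy⟩
      refine ⟨y, ?_⟩
      change fderiv ℝ t.symm (t q) (ι y) = ξ
      rw [← ht.fderiv_symm_apply hq ξ]
      exact congrArg _ hy
    · rintro ⟨y, rfl⟩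
      exact ⟨y, (ht.fderiv_apply_symm hq (ι y)).symm⟩

variable {n m a b k : ℕ} {f : RVec n × RVec m → RVec n} {O : Set (RVec n × RVec m)}
  {p : RVec n × RVec m} {h : OpenPartialHomeomorph (RVec a × RVec b × RVec k) (RVec n)}
  {t : OpenPartialHomeomorph (RVec n × RVec m) (RVec n × RVec b × RVec k)}
  {G : (RVec a × RVec b × RVec k) × RVec b → RVec a}

/-- The distribution `span(∂_w)` in the coordinates `t = (x, v, w)`. -/
noncomputable def secondInputDistribution
    (t : OpenPartialHomeomorph (RVec n × RVec m) (RVec n × RVec b × RVec k)) :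
    TangentDistribution (RVec n × RVec m) := fun q =>
  Submodule.comap (fderiv ℝ t q).toLinearMap (Submodule.prod ⊥ (Submodule.prod ⊥ ⊤))

theorem mem_secondInputDistribution {q ξ : RVec n × RVec m} :
    ξ ∈ secondInputDistribution t q ↔ (fderiv ℝ t q ξ).1 = 0 ∧ (fderiv ℝ t q ξ).2.1 = 0 := by
  simp [secondInputDistribution, Submodule.mem_prod]

/-- The inclusion of the inputs `w`. -/
noncomputable def secondInputInclusion (X Y Z : Type*) [NormedAddCommGroup X] [NormedSpace ℝ X]
    [NormedAddCommGroup Y] [NormedSpace ℝ Y] [NormedAddCommGroup Z] [NormedSpace ℝ Z] :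
    Z →L[ℝ] X × Y × Z :=
  (ContinuousLinearMap.inr ℝ X (Y × Z)).comp (ContinuousLinearMap.inr ℝ Y Z)

theorem isFrameOn_secondInputDistribution (ht : IsLocalDiffeo t) :
    IsFrameOn (fun i q => fderiv ℝ t.symm (t q)
      (secondInputInclusion (RVec n) (RVec b) (RVec k) (Pi.single i 1)))
      (secondInputDistribution t) t.source := by
  have h1 : LinearMap.range (secondInputInclusion (RVec n) (RVec b) (RVec k)).toLinearMap =
      Submodule.prod ⊥ (Submodule.prod ⊥ ⊤) := by
    ext ⟨x, y, z⟩
    simp [secondInputInclusion, Submodule.mem_prod, eq_comm]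
  have h2 := ht.isFrameOn_comap_range (secondInputInclusion (RVec n) (RVec b) (RVec k))
    fun x y hxy => by simpa [secondInputInclusion] using hxy
  rwa [h1] at h2

theorem fst_fderiv_eq (ht : IsLocalDiffeo t) (hfst : ∀ q ∈ t.source, (t q).1 = q.1)
    {q : RVec n × RVec m} (hq : q ∈ t.source) (ξ : RVec n × RVec m) :
    (fderiv ℝ t q ξ).1 = ξ.1 := by
  have h1 : HasFDerivAt (fun y => (t y).1)
      ((ContinuousLinearMap.fst ℝ _ _).comp (fderiv ℝ t q)) q :=
    (ht.differentiableAt hq).hasFDerivAt.fst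
  have h2 : HasFDerivAt (fun y => (t y).1)
      (ContinuousLinearMap.fst ℝ (RVec n) (RVec m)) q :=
    hasFDerivAt_fst.congr_of_eventuallyEq (by
      filter_upwards [t.open_source.mem_nhds hq] with y hy using hfst y hy)
  exact DFunLike.congr_fun (h1.unique h2) ξ

/-- The complement is `span(∂_v)`. It is involutive because it is the kernel of `d(x, w)`. -/
theorem hasInvolutiveComplementOn_secondInputDistribution (ht : IsLocalDiffeo t)
    (hfst : ∀ q ∈ t.source, (t q).1 = q.1) :
    HasInvolutiveComplementOn (secondInputDistribution t) t.source := by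
  let ι : RVec b →L[ℝ] RVec n × RVec b × RVec k :=
    (ContinuousLinearMap.inr ℝ (RVec n) (RVec b × RVec k)).comp
      (ContinuousLinearMap.inl ℝ (RVec b) (RVec k))
  have hι : LinearMap.range ι.toLinearMap = Submodule.prod ⊥ (Submodule.prod ⊤ ⊥) := by
    ext ⟨x, y, z⟩
    simp [ι, Submodule.mem_prod, eq_comm]
  have hframe := ht.isFrameOn_comap_range ι fun x y hxy => by simpa [ι] using hxy
  rw [hι] at hframe
  refine ⟨_, b, _, hframe, ?_, fun q hq => ⟨?_, ?_⟩⟩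
  · refine isInvolutiveOn_of_mem_iff_fderiv_eq_zero (φ := fun y => ((t y).1, (t y).2.2))
      t.open_source (ht.1.fst.prodMk ht.1.snd.snd) fun q hq ξ => ?_
    have hd := (ht.differentiableAt hq).hasFDerivAt
    rw [(hd.fst.prodMk hd.snd.snd).fderiv]
    simp [Submodule.mem_prod, Prod.ext_iff]
  · rw [Submodule.disjoint_def]
    intro ξ h1 h2
    have h3 := mem_secondInputDistribution.1 h2
    have h4 : (fderiv ℝ t q ξ).2.2 = 0 := h1.2.2
    refine (ht.bijective_fderiv hq).1 ?_
    rw [map_zero]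
    exact Prod.ext h3.1 (Prod.ext h3.2 h4)
  · refine le_antisymm (sup_le ?_ ?_) fun ξ hξ => ?_
    · intro ξ hξ
      rw [mem_verticalSpace, ← fst_fderiv_eq ht hfst hq]
      exact hξ.1
    · intro ξ hξ
      rw [mem_verticalSpace, ← fst_fderiv_eq ht hfst hq]
      exact hξ.1
    · rw [mem_verticalSpace, ← fst_fderiv_eq ht hfst hq] at hξ
      refine Submodule.mem_sup.2 ⟨fderiv ℝ t.symm (t q) (0, (fderiv ℝ t q ξ).2.1, 0), ?_,
        fderiv ℝ t.symm (t q) (0, 0, (fderiv ℝ t q ξ).2.2), ?_, ?_⟩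
      · simp [Submodule.mem_prod, ht.fderiv_apply_symm hq]
      · simp [mem_secondInputDistribution, ht.fderiv_apply_symm hq]
      · rw [← map_add]
        refine (congrArg _ ?_).trans (ht.fderiv_symm_apply hq ξ)
        simp [Prod.ext_iff, hξ]

namespace IsNormalForm

theorem mono {O' : Set (RVec n × RVec m)} (hnf : IsNormalForm f O p h t G) (hO : O ⊆ O') :
    IsNormalForm f O' p h t G :=
  ⟨hnf.1, hnf.2.1, hnf.2.2.1, hnf.2.2.2.1.trans hO, hnf.2.2.2.2⟩

theorem differentiableAt (hnf : IsNormalForm f O p h t G) (hO : IsOpen O)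
    (hf : ContDiffOn ℝ ∞ f O) {q : RVec n × RVec m} (hq : q ∈ t.source) :
    DifferentiableAt ℝ f q :=
  hf.differentiableAt_of_isOpen hO (hnf.2.2.2.1 hq)

theorem hasFDerivAt_symm_comp (hnf : IsNormalForm f O p h t G) (hO : IsOpen O)
    (hf : ContDiffOn ℝ ∞ f O) {q : RVec n × RVec m} (hq : q ∈ t.source) :
    HasFDerivAt (fun y => h.symm (f y)) ((fderiv ℝ h.symm (f q)).comp (fderiv ℝ f q)) q :=
  ((hnf.1.symm.differentiableAt (hnf.2.2.2.2.1 q hq).2.2).hasFDerivAt).comp q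
    (hnf.differentiableAt hO hf hq).hasFDerivAt

/-- Along the line `t q + s (0, 0, ζ)` both `x` and `v` are constant, so `h⁻¹ ∘ f` is affine in `s`
there. Differentiating along this curve avoids any derivative of `G`. -/
theorem fderiv_symm_second (hnf : IsNormalForm f O p h t G) (hO : IsOpen O)
    (hf : ContDiffOn ℝ ∞ f O) {q : RVec n × RVec m} (hq : q ∈ t.source) (ζ : RVec k) :
    fderiv ℝ h.symm (f q) (fderiv ℝ f q (fderiv ℝ t.symm (t q) (0, 0, ζ))) = (0, 0, ζ) := by
  have hc₁ : HasDerivAt (fun s : ℝ => t q + s • ((0, 0, ζ) : RVec n × RVec b × RVec k))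
      (0, 0, ζ) 0 := by
    simpa using ((hasDerivAt_id (0 : ℝ)).smul_const
      ((0, 0, ζ) : RVec n × RVec b × RVec k)).const_add (t q)
  have h0 : t q + (0 : ℝ) • ((0, 0, ζ) : RVec n × RVec b × RVec k) = t q := by simp
  have hc₂ : HasDerivAt (fun s : ℝ => t.symm (t q + s • (0, 0, ζ)))
      (fderiv ℝ t.symm (t q) (0, 0, ζ)) 0 := by
    have h1 := (hnf.2.1.symm.differentiableAt (t.map_source hq)).hasFDerivAt
    rw [← h0] at h1
    have h2 := h1.comp_hasDerivAt (0 : ℝ) hc₁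
    rwa [h0] at h2
  have hq0 : t.symm (t q + (0 : ℝ) • (0, 0, ζ)) = q := by rw [h0, t.left_inv hq]
  have hc₃ : HasDerivAt (fun s : ℝ => h.symm (f (t.symm (t q + s • (0, 0, ζ)))))
      (fderiv ℝ h.symm (f q) (fderiv ℝ f q (fderiv ℝ t.symm (t q) (0, 0, ζ)))) 0 := by
    have h1 := hnf.hasFDerivAt_symm_comp hO hf hq
    rw [← hq0] at h1
    have h2 := h1.comp_hasDerivAt (0 : ℝ) hc₂
    rwa [hq0] at h2
  have hc₄ : HasDerivAt (fun s : ℝ => h.symm (f (t.symm (t q + s • (0, 0, ζ)))))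
      ((0, 0, ζ) : RVec a × RVec b × RVec k) 0 := by
    have h1 : HasDerivAt (fun s : ℝ => h.symm (f q) +
        s • ((0, 0, ζ) : RVec a × RVec b × RVec k)) (0, 0, ζ) 0 := by
      simpa using ((hasDerivAt_id (0 : ℝ)).smul_const
        ((0, 0, ζ) : RVec a × RVec b × RVec k)).const_add (h.symm (f q))
    refine h1.congr_of_eventuallyEq ?_
    have h2 : ∀ᶠ s : ℝ in 𝓝 0, t q + s • ((0, 0, ζ) : RVec n × RVec b × RVec k) ∈ t.target := by
      refine hc₁.continuousAt.eventually_mem ?_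
      rw [h0]
      exact t.open_target.mem_nhds (t.map_source hq)
    filter_upwards [h2] with s hs
    have hs' := t.map_target hs
    rw [hnf.2.2.2.2.2.2 _ hs', hnf.2.2.2.2.2.2 q hq, ← (hnf.2.2.2.2.1 _ hs').1, t.right_inv hs,
      ← (hnf.2.2.2.2.1 q hq).1]
    simp [Prod.ext_iff]
  exact hc₃.unique hc₄

theorem fderiv_second (hnf : IsNormalForm f O p h t G) (hO : IsOpen O)
    (hf : ContDiffOn ℝ ∞ f O) {q : RVec n × RVec m} (hq : q ∈ t.source) (ζ : RVec k) :
    fderiv ℝ f q (fderiv ℝ t.symm (t q) (0, 0, ζ)) = fderiv ℝ h (h.symm (f q)) (0, 0, ζ) := by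
  have hfq := (hnf.2.2.2.2.1 q hq).2.2
  have h1 := hnf.1.symm.fderiv_symm_apply hfq
    (fderiv ℝ f q (fderiv ℝ t.symm (t q) (0, 0, ζ)))
  rw [hnf.fderiv_symm_second hO hf hq] at h1
  exact h1.symm

theorem secondInputDistribution_le (hnf : IsNormalForm f O p h t G) {q : RVec n × RVec m}
    (hq : q ∈ t.source) : secondInputDistribution t q ≤ verticalSpace n m := by
  intro ξ hξ
  rw [mem_verticalSpace, ← fst_fderiv_eq hnf.2.1 (fun y hy => (hnf.2.2.2.2.1 y hy).1) hq]
  exact hξ.1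

/-- The push-forward of `∂_w` is a coordinate field of `h`, which depends on `f q` alone. -/
theorem isProjectableDistributionOn (hnf : IsNormalForm f O p h t G) (hO : IsOpen O)
    (hf : ContDiffOn ℝ ∞ f O) :
    IsProjectableDistributionOn f (secondInputDistribution t) k t.source := by
  have hframe := isFrameOn_secondInputDistribution hnf.2.1
  refine ⟨fun q hq => hnf.secondInputDistribution_le hq, _, hframe, fun i => ⟨hframe.1 i,
    fun y => fderiv ℝ h (h.symm y) (0, 0, Pi.single i 1), ?_, fun q hq => ?_⟩⟩
  · have h1 : ContDiffOn ℝ ∞ (fun y => fderiv ℝ h (h.symm y) (0, 0, Pi.single i 1)) h.target := by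
      refine ContDiffOn.clm_apply ?_ contDiffOn_const
      exact (hnf.1.1.fderiv_infty h.open_source).comp hnf.1.2 fun y hy => h.map_target hy
    refine h1.mono ?_
    rintro _ ⟨q, hq, rfl⟩
    exact (hnf.2.2.2.2.1 q hq).2.2
  · exact hnf.fderiv_second hO hf hq _

theorem isExactBasisOn (hnf : IsNormalForm f O p h t G) (hO : IsOpen O)
    (hf : ContDiffOn ℝ ∞ f O) (hsub : ∀ q ∈ O, Function.Surjective (fderiv ℝ f q)) :
    IsExactBasisOn (Sum.elim (fun i q => (h.symm (f q)).1 i) (fun j q => (h.symm (f q)).2.1 j))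
      (reducedCodistribution f (secondInputDistribution t)) t.source := by
  have hψ : ContDiffOn ℝ ∞ (fun y => h.symm (f y)) t.source :=
    hnf.1.2.comp (hf.mono hnf.2.2.2.1) fun q hq => (hnf.2.2.2.2.1 q hq).2.2
  have hd : ∀ q ∈ t.source, ∀ (i : Fin a ⊕ Fin b) (ξ : RVec n × RVec m),
      fderiv ℝ (Sum.elim (fun i q => (h.symm (f q)).1 i) (fun j q => (h.symm (f q)).2.1 j) i) q ξ =
        Sum.elim (fderiv ℝ h.symm (f q) (fderiv ℝ f q ξ)).1
          (fderiv ℝ h.symm (f q) (fderiv ℝ f q ξ)).2.1 i := by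
    intro q hq i ξ
    have h1 := hnf.hasFDerivAt_symm_comp hO hf hq
    rcases i with i | j
    · exact DFunLike.congr_fun (hasFDerivAt_pi'.1 h1.fst i).fderiv ξ
    · exact DFunLike.congr_fun (hasFDerivAt_pi'.1 h1.snd.fst j).fderiv ξ
  refine IsExactBasisOn.of_mem_iff ?_ ?_ ?_
  · rintro (i | j)
    · exact contDiffOn_pi.1 hψ.fst i
    · exact contDiffOn_pi.1 hψ.snd.fst j
  · intro q hq y
    have hfq := (hnf.2.2.2.2.1 q hq).2.2
    obtain ⟨η, hη⟩ := (hnf.1.symm.bijective_fderiv hfq).2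
      (fun i => y (Sum.inl i), fun j => y (Sum.inr j), 0)
    obtain ⟨ξ, rfl⟩ := hsub q (hnf.2.2.2.1 hq) η
    refine ⟨ξ, funext fun i => ?_⟩
    simp only [hd q hq, hη]
    rcases i with i | j <;> rfl
  · intro q hq α
    have hfq := (hnf.2.2.2.2.1 q hq).2.2
    have hker : ∀ ξ, (∀ i, fderiv ℝ (Sum.elim (fun i q => (h.symm (f q)).1 i)
        (fun j q => (h.symm (f q)).2.1 j) i) q ξ = 0) ↔
        (fderiv ℝ h.symm (f q) (fderiv ℝ f q ξ)).1 = 0 ∧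
          (fderiv ℝ h.symm (f q) (fderiv ℝ f q ξ)).2.1 = 0 := by
      intro ξ
      simp only [hd q hq, Sum.forall, Sum.elim_inl, Sum.elim_inr, funext_iff, Pi.zero_apply]
    have hW : ∀ ζ : RVec k, fderiv ℝ t.symm (t q) (0, 0, ζ) ∈ secondInputDistribution t q := by
      intro ζ
      simp [mem_secondInputDistribution, hnf.2.1.fderiv_apply_symm hq]
    have hfd := hnf.differentiableAt hO hf hq
    constructor
    · rintro ⟨h1, h2⟩ ξ hξ
      have h3 := (hker ξ).1 hξ
      -- Subtracting the vector of `span(∂_w)` with the same last component moves `ξ` into `ker df`;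
      -- so the common kernel of the differentials is `ker df + span(∂_w)`.
      set ζ := (fderiv ℝ h.symm (f q) (fderiv ℝ f q ξ)).2.2 with hζ
      have h4 : fderiv ℝ f q (ξ - fderiv ℝ t.symm (t q) (0, 0, ζ)) = 0 := by
        refine (hnf.1.symm.bijective_fderiv hfq).1 ?_
        rw [map_sub, map_sub, map_zero, hnf.fderiv_symm_second hO hf hq, sub_eq_zero]
        exact Prod.ext h3.1 (Prod.ext h3.2 rfl)
      have h5 := (mem_spanDifferentials_iff hfd α).1 h1 _ h4
      rwa [map_sub, h2 _ (hW ζ), sub_zero] at h5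
    · refine fun hα => ⟨(mem_spanDifferentials_iff hfd α).2 fun ξ hξ => hα ξ ?_,
        fun w hw => hα w ?_⟩
      · rw [hker, hξ]
        simp
      · have h1 := mem_secondInputDistribution.1 hw
        have h2 : w = fderiv ℝ t.symm (t q) (0, 0, (fderiv ℝ t q w).2.2) := by
          rw [← hnf.2.1.fderiv_symm_apply hq w]
          refine congrArg _ ?_
          rw [hnf.2.1.fderiv_symm_apply hq w]
          exact Prod.ext h1.1 (Prod.ext h1.2 rfl)
        rw [hker, h2, hnf.fderiv_symm_second hO hf hq]
        simp

end IsNormalForm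

end NormalForm

/-! ### Extending a state transformation to a second point -/

section DisjointUnion

variable {E F : Type*} [NormedAddCommGroup E] [NormedSpace ℝ E]
  [NormedAddCommGroup F] [NormedSpace ℝ F]

open Classical in
theorem IsLocalDiffeo.exists_disjointUnion {e e' : OpenPartialHomeomorph E F}
    (he : IsLocalDiffeo e) (he' : IsLocalDiffeo e') (hs : Disjoint e.source e'.source)
    (ht : Disjoint e.target e'.target) :
    ∃ d : OpenPartialHomeomorph E F, IsLocalDiffeo d ∧ d.source = e.source ∪ e'.source ∧
      Set.EqOn d e e.source := by
  have h1 : Set.EqOn (e.disjointUnion e' hs ht) e e.source := fun x hx =>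
    Set.piecewise_eq_of_mem e.source e e' hx
  have h2 : Set.EqOn (e.disjointUnion e' hs ht) e' e'.source := fun x hx =>
    Set.piecewise_eq_of_notMem e.source e e' (Set.disjoint_right.1 hs hx)
  have h3 : Set.EqOn (e.disjointUnion e' hs ht).symm e.symm e.target := fun x hx =>
    Set.piecewise_eq_of_mem e.target e.symm e'.symm hx
  have h4 : Set.EqOn (e.disjointUnion e' hs ht).symm e'.symm e'.target := fun x hx =>
    Set.piecewise_eq_of_notMem e.target e.symm e'.symm (Set.disjoint_right.1 ht hx)
  refine ⟨e.disjointUnion e' hs ht, ⟨?_, ?_⟩, rfl, h1⟩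
  · exact (he.1.congr h1).union_of_isOpen (he'.1.congr h2) e.open_source e'.open_source
  · exact (he.2.congr h3).union_of_isOpen (he'.2.congr h4) e.open_target e'.open_target

/-- A local diffeomorphism near `y` agrees near `y` with one whose (possibly disconnected) source
contains a second given point. -/
theorem IsLocalDiffeo.exists_extend_source [FiniteDimensional ℝ E] [FiniteDimensional ℝ F]
    {s : OpenPartialHomeomorph E F} (hs : IsLocalDiffeo s) {y : E} (hy : y ∈ s.source) (x : E) :
    ∃ s' : OpenPartialHomeomorph E F, IsLocalDiffeo s' ∧ x ∈ s'.source ∧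
      ∃ B ⊆ s.source, IsOpen B ∧ y ∈ B ∧ B ⊆ s'.source ∧ Set.EqOn s' s B := by
  rcases eq_or_ne x y with rfl | hxy
  · exact ⟨s, hs, hy, s.source, subset_rfl, s.open_source, hy, subset_rfl, Set.eqOn_refl _ _⟩
  have hb := hs.bijective_fderiv hy
  have : Nontrivial E := ⟨x, y, hxy⟩
  have : Nontrivial F := hb.1.nontrivial
  -- With `‖c₀‖ > 2` the unit balls about `s y` and `s y + c₀` are disjoint. The second piece is an
  -- affine map near `x` with linear part `ds(y)`, shifted so that it lands in the second ball.
  obtain ⟨c₀, hc₀⟩ := NormedSpace.exists_lt_norm ℝ F 2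
  obtain ⟨Bx, By, hBx, hBy, hxB, hyB, hdis⟩ := t2_separation hxy
  let D := fderiv ℝ s y
  let A : E → F := fun z => D (z - x) + (s y + c₀)
  have hA : ContDiff ℝ ∞ A := (D.contDiff.comp (contDiff_id.sub contDiff_const)).add
    contDiff_const
  have hAx : A x = s y + c₀ := by simp [A]
  have hAd : HasFDerivAt A D x := by
    have h1 := (D.hasFDerivAt (x := x - x)).comp (f := fun z => z - x) x
      ((hasFDerivAt_id x).sub_const x)
    exact h1.add_const (s y + c₀)
  obtain ⟨e', he', hxe', he's, he'A⟩ := exists_isLocalDiffeo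
    (N := Bx ∩ A ⁻¹' Metric.ball (s y + c₀) 1)
    (hBx.inter (Metric.isOpen_ball.preimage hA.continuous)) hA.contDiffOn
    (p := x) ⟨hxB, by simp [hAx]⟩ (by rw [hAd.fderiv]; exact hb)
  have hV : IsOpen (s.source ∩ s ⁻¹' Metric.ball (s y) 1 ∩ By) :=
    (s.isOpen_inter_preimage Metric.isOpen_ball).inter hBy
  let e := s.restrOpen _ hV
  have hes : e.source = s.source ∩ s ⁻¹' Metric.ball (s y) 1 ∩ By := by
    simp only [e, OpenPartialHomeomorph.restrOpen_source]
    exact Set.inter_eq_right.2 fun z hz => hz.1.1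
  have hye : y ∈ e.source := by
    rw [hes]
    exact ⟨⟨hy, by simp⟩, hyB⟩
  have hst : Disjoint e.source e'.source := by
    rw [Set.disjoint_left]
    intro z hz hz'
    rw [hes] at hz
    exact Set.disjoint_left.1 hdis (he's hz').1 hz.2
  have htt : Disjoint e.target e'.target := by
    rw [Set.disjoint_left]
    intro z hz hz'
    have h1 := e.map_target hz
    rw [hes] at h1
    have h2 : s (e.symm z) = z := e.right_inv hz
    have h3 : z ∈ Metric.ball (s y) 1 := h2 ▸ h1.1.2
    have h4 : A (e'.symm z) ∈ Metric.ball (s y + c₀) 1 := (he's (e'.map_target hz')).2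
    rw [← he'A, e'.right_inv hz', mem_ball_iff_norm] at h4
    rw [mem_ball_iff_norm] at h3
    have h5 : ‖c₀‖ ≤ ‖z - s y‖ + ‖z - (s y + c₀)‖ := by
      refine le_trans (le_of_eq ?_) (norm_sub_le _ _)
      congr 1
      abel
    linarith
  obtain ⟨d, hd, hds, hde⟩ := (hs.restrOpen hV).exists_disjointUnion he' hst htt
  refine ⟨d, hd, ?_, e.source, ?_, e.open_source, hye, ?_, hde⟩
  · rw [hds]
    exact Or.inr hxe'
  · rw [hes]
    exact fun z hz => hz.1.1
  · rw [hds]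
    exact Set.subset_union_left

/-- A surjective linear map can be completed to an isomorphism. -/
theorem LinearMap.exists_bijective_prod {X Y : Type*} [AddCommGroup X] [Module ℝ X]
    [AddCommGroup Y] [Module ℝ Y] [FiniteDimensional ℝ X] [FiniteDimensional ℝ Y] {m : ℕ}
    (L : X →ₗ[ℝ] Y) (hL : Function.Surjective L)
    (hdim : Module.finrank ℝ X = Module.finrank ℝ Y + m) :
    ∃ M : X →ₗ[ℝ] RVec m, Function.Bijective (L.prod M) := by
  have h1 : Module.finrank ℝ (LinearMap.ker L) = Module.finrank ℝ (RVec m) := by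
    have h2 := L.finrank_range_add_finrank_ker
    rw [LinearMap.range_eq_top.2 hL, finrank_top, hdim] at h2
    rw [Module.finrank_fin_fun]
    omega
  obtain ⟨π, hπ⟩ := (LinearMap.ker L).subtype.exists_leftInverse_of_injective
    (LinearMap.ker L).ker_subtype
  have hinj : Function.Injective (L.prod ((LinearEquiv.ofFinrankEq _ _ h1).toLinearMap ∘ₗ π)) := by
    refine (injective_iff_map_eq_zero _).2 fun ξ hξ => ?_
    have h2 : L ξ = 0 := congrArg Prod.fst hξ
    have h3 : π ξ = 0 := (LinearEquiv.ofFinrankEq _ _ h1).injective (by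
      rw [map_zero]
      exact congrArg Prod.snd hξ)
    have h4 := DFunLike.congr_fun hπ ⟨ξ, h2⟩
    change π ξ = _ at h4
    rw [h3] at h4
    exact (congrArg Subtype.val h4).symm
  exact ⟨_, hinj, (LinearMap.injective_iff_surjective_of_finrank_eq_finrank (by
    rw [hdim, Module.finrank_prod, Module.finrank_fin_fun])).1 hinj⟩

end DisjointUnion

/-! ### Construction of the normal form -/

section Construction

variable {n m a b k : ℕ} {f : RVec n × RVec m → RVec n}
  {N : Set (RVec n × RVec m)} {p : RVec n × RVec m} {W : TangentDistribution (RVec n × RVec m)}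
  {g : Fin a ⊕ Fin b → RVec n × RVec m → ℝ} {τ : Fin k → Fin n}

theorem IsExactBasisOn.hasFDerivAt_inl (hg : IsExactBasisOn g (reducedCodistribution f W) N)
    (hN : IsOpen N) {q : RVec n × RVec m} (hq : q ∈ N) :
    HasFDerivAt (fun y i => g (Sum.inl i) y)
      (ContinuousLinearMap.pi fun i => fderiv ℝ (g (Sum.inl i)) q) q :=
  _root_.hasFDerivAt_pi.2 fun _ => ((hg.1 _).differentiableAt_of_isOpen hN hq).hasFDerivAt

theorem hasFDerivAt_newInputs (hN : IsOpen N) (hf : ContDiffOn ℝ ∞ f N)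
    (hg : IsExactBasisOn g (reducedCodistribution f W) N) {q : RVec n × RVec m} (hq : q ∈ N) :
    HasFDerivAt (newInputs f g τ)
      ((ContinuousLinearMap.pi fun j => fderiv ℝ (g (Sum.inr j)) q).prod
        (ContinuousLinearMap.pi fun i => (ContinuousLinearMap.proj (τ i)).comp (fderiv ℝ f q))) q :=
  (_root_.hasFDerivAt_pi.2 fun _ =>
    ((hg.1 _).differentiableAt_of_isOpen hN hq).hasFDerivAt).prodMk
    (_root_.hasFDerivAt_pi.2 fun i =>
      hasFDerivAt_pi'.1 (hf.differentiableAt_of_isOpen hN hq).hasFDerivAt (τ i))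

theorem contDiffOn_newInputs (hf : ContDiffOn ℝ ∞ f N)
    (hg : IsExactBasisOn g (reducedCodistribution f W) N) :
    ContDiffOn ℝ ∞ (newInputs f g τ) N :=
  (_root_.contDiffOn_pi.2 fun _ => hg.1 _).prodMk
    (_root_.contDiffOn_pi.2 fun i => _root_.contDiffOn_pi.1 hf (τ i))

/-- The input transformation by the new inputs. -/
theorem exists_inputTransformation (hN : IsOpen N) (hp : p ∈ N) (hf : ContDiffOn ℝ ∞ f N)
    (hg : IsExactBasisOn g (reducedCodistribution f W) N) (hτ : IsSorted f g τ p) :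
    ∃ t : OpenPartialHomeomorph (RVec n × RVec m) (RVec n × RVec b × RVec k),
      IsLocalDiffeo t ∧ p ∈ t.source ∧ t.source ⊆ N ∧ ∀ q, t q = (q.1, newInputs f g τ q) := by
  have hν := contDiffOn_newInputs (τ := τ) hf hg
  refine exists_isLocalDiffeo hN (contDiffOn_fst.prodMk hν) hp ?_
  rw [(hasFDerivAt_fst.prodMk (hν.differentiableAt_of_isOpen hN hp).hasFDerivAt).fderiv]
  -- The differential of `(x, u) ↦ (x, v, w)` is block triangular, so its invertibility reduces to
  -- that of `∂_u(v, w)`.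
  have hsplit : ∀ ξ : RVec n × RVec m, fderiv ℝ (newInputs f g τ) p ξ =
      fderiv ℝ (newInputs f g τ) p (ξ.1, 0) +
        ((fderiv ℝ (newInputs f g τ) p).comp (ContinuousLinearMap.inr ℝ _ _)) ξ.2 := by
    intro ξ
    rw [ContinuousLinearMap.comp_apply, ← map_add]
    simp
  constructor
  · refine (injective_iff_map_eq_zero _).2 fun ξ hξ => ?_
    have h1 : ξ.1 = 0 := congrArg Prod.fst hξ
    have h2 : fderiv ℝ (newInputs f g τ) p ξ = 0 := congrArg Prod.snd hξ
    rw [hsplit, h1, Prod.mk_zero_zero, map_zero, zero_add] at h2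
    refine Prod.ext h1 (hτ.1 ?_)
    rw [h2, Prod.snd_zero, map_zero]
  · rintro ⟨x, y⟩
    obtain ⟨u, hu⟩ := hτ.2 (y - fderiv ℝ (newInputs f g τ) p (x, 0))
    refine ⟨(x, u), Prod.ext rfl ?_⟩
    change fderiv ℝ (newInputs f g τ) p (x, u) = y
    rw [hsplit, hu]
    simp

theorem finrank_secondInputDistribution
    {t : OpenPartialHomeomorph (RVec n × RVec m) (RVec n × RVec b × RVec k)}
    (ht : IsLocalDiffeo t) {q : RVec n × RVec m} (hq : q ∈ t.source) :
    Module.finrank ℝ (secondInputDistribution t q) = k := by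
  have h1 := (isFrameOn_secondInputDistribution ht).2 q hq
  rw [h1.2, finrank_span_eq_card h1.1, Fintype.card_fin]

/-- `W` is vertical and annihilated by `dv`, hence lies in `span(∂_w)`; both have dimension `k`. -/
theorem eq_secondInputDistribution (hN : IsOpen N) (hf : ContDiffOn ℝ ∞ f N)
    (hW : ∀ q ∈ N, W q ≤ verticalSpace n m) (hk : ∀ q ∈ N, Module.finrank ℝ (W q) = k)
    (hg : IsExactBasisOn g (reducedCodistribution f W) N)
    {t : OpenPartialHomeomorph (RVec n × RVec m) (RVec n × RVec b × RVec k)}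
    (ht : IsLocalDiffeo t) (htN : t.source ⊆ N) (htν : ∀ q, t q = (q.1, newInputs f g τ q))
    {q : RVec n × RVec m} (hq : q ∈ t.source) : W q = secondInputDistribution t q := by
  refine Submodule.eq_of_le_of_finrank_eq (fun ξ hξ => ?_) ?_
  · rw [mem_secondInputDistribution, show (t : RVec n × RVec m → RVec n × RVec b × RVec k) =
      fun q => (q.1, newInputs f g τ q) from funext htν,
      (hasFDerivAt_fst.prodMk (hasFDerivAt_newInputs hN hf hg (htN hq))).fderiv]
    refine ⟨mem_verticalSpace.1 (hW q (htN hq) hξ), funext fun j => ?_⟩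
    exact (hg.fderiv_mem (htN hq) (Sum.inr j)).2 ξ hξ
  · rw [hk q (htN hq), finrank_secondInputDistribution ht hq]

/-- The functions `(gˡ, v, w)` factor through `f` near `p`, by a local diffeomorphism. -/
theorem exists_stateDiffeo (hN : IsOpen N) (hp : p ∈ N) (hf : ContDiffOn ℝ ∞ f N)
    (hsub : ∀ q ∈ N, Function.Surjective (fderiv ℝ f q)) (hn : a + b + k = n)
    (hg : IsExactBasisOn g (reducedCodistribution f W) N)
    {t : OpenPartialHomeomorph (RVec n × RVec m) (RVec n × RVec b × RVec k)}
    (ht : IsLocalDiffeo t) (hpt : p ∈ t.source)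
    (htν : ∀ q, t q = (q.1, newInputs f g τ q))
    (hWt : ∀ q ∈ t.source, W q = secondInputDistribution t q) :
    ∃ s : OpenPartialHomeomorph (RVec n) (RVec a × RVec b × RVec k), IsLocalDiffeo s ∧
      ∃ N' ⊆ N, IsOpen N' ∧ p ∈ N' ∧
        ∀ q ∈ N', f q ∈ s.source ∧ s (f q) = (fun i => g (Sum.inl i) q, newInputs f g τ q) := by
  have hψ : ContDiffOn ℝ ∞ (fun q => ((fun i => g (Sum.inl i) q, newInputs f g τ q) :
      RVec a × RVec b × RVec k)) N :=
    (_root_.contDiffOn_pi.2 fun _ => hg.1 _).prodMk (contDiffOn_newInputs hf hg)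
  have hψd : ∀ q ∈ N, ∀ ξ, fderiv ℝ (fun q => ((fun i => g (Sum.inl i) q, newInputs f g τ q) :
      RVec a × RVec b × RVec k)) q ξ = (fun i => fderiv ℝ (g (Sum.inl i)) q ξ,
        fun j => fderiv ℝ (g (Sum.inr j)) q ξ, fun i => fderiv ℝ f q ξ (τ i)) := by
    intro q hq ξ
    rw [((hg.hasFDerivAt_inl hN hq).prodMk (hasFDerivAt_newInputs hN hf hg hq)).fderiv]
    rfl
  have hker : ∀ q ∈ N, ∀ ξ, fderiv ℝ f q ξ = 0 →
      fderiv ℝ (fun q => ((fun i => g (Sum.inl i) q, newInputs f g τ q) :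
        RVec a × RVec b × RVec k)) q ξ = 0 := by
    intro q hq ξ hξ
    have h1 : ∀ i, fderiv ℝ (g i) q ξ = 0 := fun i =>
      (mem_spanDifferentials_iff (hf.differentiableAt_of_isOpen hN hq) _).1
        (hg.fderiv_mem hq i).1 ξ hξ
    rw [hψd q hq]
    simp only [h1, hξ]
    rfl
  obtain ⟨N₁, hN₁N, hN₁, hpN₁, himage, η, hη, hηf⟩ := exists_smooth_factor hN hf hψ hp
    (hsub p hp) hker
  have hfp : f p ∈ f '' N₁ := ⟨p, hpN₁, rfl⟩
  have hηd : ∀ ξ, fderiv ℝ η (f p) (fderiv ℝ f p ξ) =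
      (fun i => fderiv ℝ (g (Sum.inl i)) p ξ,
        fun j => fderiv ℝ (g (Sum.inr j)) p ξ, fun i => fderiv ℝ f p ξ (τ i)) := by
    intro ξ
    rw [← hψd p hp]
    have h1 := (hη.differentiableAt_of_isOpen himage hfp).hasFDerivAt.comp p
      (hf.differentiableAt_of_isOpen hN hp).hasFDerivAt
    have h2 := h1.congr_of_eventuallyEq (f₁ := fun q =>
      ((fun i => g (Sum.inl i) q, newInputs f g τ q) : RVec a × RVec b × RVec k)) (by
        filter_upwards [hN₁.mem_nhds hpN₁] with q hq using hηf q hq)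
    rw [h2.fderiv]
    rfl
  -- The independent `dgⁱ` attain `(α, β)` at some `ξ`. A vector `ζ ∈ W` then corrects the
  -- `w`-component, and the `dgⁱ` do not see it.
  have hηs : Function.Surjective (fderiv ℝ η (f p)) := by
    rintro ⟨α, β, γ⟩
    obtain ⟨ξ, hξ⟩ := hg.surjective hp (Sum.elim α β)
    have hξ' := congrFun hξ
    obtain ⟨ζ, hζ⟩ := (ht.bijective_fderiv hpt).2 (0, 0, γ - fun i => fderiv ℝ f p ξ (τ i))
    have hζW : ζ ∈ W p := by
      rw [hWt p hpt, mem_secondInputDistribution, hζ]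
      exact ⟨rfl, rfl⟩
    have hζ0 : ∀ i, fderiv ℝ (g i) p ζ = 0 := fun i => (hg.fderiv_mem hp i).2 ζ hζW
    have hζ1 : ∀ i, fderiv ℝ f p ζ (τ i) = γ i - fderiv ℝ f p ξ (τ i) := by
      rw [show (t : RVec n × RVec m → RVec n × RVec b × RVec k) =
        fun q => (q.1, newInputs f g τ q) from funext htν,
        (hasFDerivAt_fst.prodMk (hasFDerivAt_newInputs hN hf hg hp)).fderiv] at hζ
      exact congrFun (congrArg (fun y => y.2.2) hζ)
    refine ⟨fderiv ℝ f p (ξ + ζ), ?_⟩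
    rw [hηd]
    refine Prod.ext (funext fun i => ?_) (Prod.ext (funext fun j => ?_) (funext fun i => ?_))
    · simpa [hζ0] using hξ' (Sum.inl i)
    · simpa [hζ0] using hξ' (Sum.inr j)
    · simp [hζ1]
  have hηb : Function.Bijective (fderiv ℝ η (f p)) := by
    refine ⟨?_, hηs⟩
    refine (LinearMap.injective_iff_surjective_of_finrank_eq_finrank
      (f := (fderiv ℝ η (f p)).toLinearMap) ?_).2 hηs
    simp only [Module.finrank_prod, Module.finrank_fin_fun]
    omega
  obtain ⟨s, hs, hfps, hsN, hsη⟩ := exists_isLocalDiffeo himage hη hfp hηb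
  refine ⟨s, hs, N₁ ∩ f ⁻¹' s.source, fun q hq => hN₁N hq.1,
    (hf.continuousOn.mono hN₁N).isOpen_inter_preimage hN₁ s.open_source, ⟨hpN₁, hfps⟩,
    fun q hq => ⟨hq.2, ?_⟩⟩
  rw [hsη, ← hηf q hq.1]

/-- Functions of `(x, v)` with independent differentials together with `v` can be completed to a
local diffeomorphism `(x, v) ↦ (z, v)`. -/
theorem exists_completion (hn : a + m = n) {Ω : Set (RVec n × RVec b)} (hΩ : IsOpen Ω)
    {γ : RVec n × RVec b → RVec a} (hγ : ContDiffOn ℝ ∞ γ Ω) {y : RVec n × RVec b} (hy : y ∈ Ω)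
    (hs : ∀ α, ∃ x, fderiv ℝ γ y (x, 0) = α) :
    ∃ pc : OpenPartialHomeomorph (RVec n × RVec b) ((RVec a × RVec m) × RVec b),
      IsLocalDiffeo pc ∧ y ∈ pc.source ∧ pc.source ⊆ Ω ∧
        ∀ z, (pc z).1.1 = γ z ∧ (pc z).2 = z.2 := by
  let L : RVec n →ₗ[ℝ] RVec a :=
    (fderiv ℝ γ y).toLinearMap ∘ₗ LinearMap.inl ℝ (RVec n) (RVec b)
  obtain ⟨M, hM⟩ := L.exists_bijective_prod (m := m) hs (by simp [hn])
  let M' : RVec n →L[ℝ] RVec m := LinearMap.toContinuousLinearMap M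
  have hd : HasFDerivAt (fun z : RVec n × RVec b => ((γ z, M' z.1), z.2))
      (((fderiv ℝ γ y).prod (M'.comp (ContinuousLinearMap.fst ℝ _ _))).prod
        (ContinuousLinearMap.snd ℝ _ _)) y :=
    (((hγ.differentiableAt_of_isOpen hΩ hy).hasFDerivAt).prodMk
      (M'.hasFDerivAt.comp y hasFDerivAt_fst)).prodMk hasFDerivAt_snd
  have hsplit : ∀ (x : RVec n) (v : RVec b),
      fderiv ℝ γ y (x, v) = L x + fderiv ℝ γ y (0, v) := by
    intro x v
    change _ = fderiv ℝ γ y (x, 0) + fderiv ℝ γ y (0, v)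
    rw [← map_add]
    simp
  obtain ⟨pc, hpc, hypc, hpcΩ, hpce⟩ := exists_isLocalDiffeo hΩ
    ((hγ.prodMk (M'.contDiff.comp contDiff_fst).contDiffOn).prodMk contDiffOn_snd) hy (by
      change Function.Bijective (fderiv ℝ (fun z => ((γ z, M' z.1), z.2)) y)
      rw [hd.fderiv]
      constructor
      · refine (injective_iff_map_eq_zero _).2 ?_
        rintro ⟨x, v⟩ hξ
        have h1 : v = 0 := congrArg Prod.snd hξ
        subst h1
        have h2 : fderiv ℝ γ y (x, 0) = 0 := congrArg (fun z => z.1.1) hξ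
        have h3 : M x = 0 := congrArg (fun z => z.1.2) hξ
        have h4 : x = 0 := hM.1 ((Prod.ext h2 h3 : L.prod M x = 0).trans (map_zero _).symm)
        rw [h4, Prod.mk_zero_zero]
      · rintro ⟨⟨α, μ⟩, v⟩
        obtain ⟨x, hx⟩ := hM.2 (α - fderiv ℝ γ y (0, v), μ)
        have h2 : L x = α - fderiv ℝ γ y (0, v) := congrArg Prod.fst hx
        have h3 : M x = μ := congrArg Prod.snd hx
        refine ⟨(x, v), Prod.ext (Prod.ext ?_ h3) rfl⟩
        change fderiv ℝ γ y (x, v) = α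
        rw [hsplit, h2, sub_add_cancel])
  refine ⟨pc, hpc, hypc, hpcΩ, fun z => ?_⟩
  rw [hpce]
  exact ⟨rfl, rfl⟩

/-- The tuple `(gˡ, v, w)` is read in two ways: as `s ∘ f` with `s` a local diffeomorphism, and,
since `W = span(∂_w)` kills `dgˡ`, as `(γ(x, v), v, w)`. Equating the two gives the normal form with
`h = s⁻¹`. -/
theorem constructionYieldsNormalForm (hN : IsOpen N) (hp : p ∈ N) (hf : ContDiffOn ℝ ∞ f N)
    (hsub : ∀ q ∈ N, Function.Surjective (fderiv ℝ f q)) (hn : a + b + k = n) (hm : b + k = m)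
    (hW : ∀ q ∈ N, W q ≤ verticalSpace n m) (hk : ∀ q ∈ N, Module.finrank ℝ (W q) = k)
    (hg : IsExactBasisOn g (reducedCodistribution f W) N) (hτ : IsSorted f g τ p) :
    ConstructionYieldsNormalForm f N p W g τ := by
  obtain ⟨t₀, ht₀, hpt₀, ht₀N, ht₀ν⟩ := exists_inputTransformation hN hp hf hg hτ
  have hWt₀ : ∀ q ∈ t₀.source, W q = secondInputDistribution t₀ q := fun q hq =>
    eq_secondInputDistribution hN hf hW hk hg ht₀ ht₀N ht₀ν hq
  obtain ⟨s, hs, N₂, hN₂N, hN₂, hpN₂, hsf⟩ :=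
    exists_stateDiffeo hN hp hf hsub hn hg ht₀ hpt₀ ht₀ν hWt₀
  -- So far `s` is a chart near `f p` only, whereas `x = h(z)` also needs one near `p.1`.
  obtain ⟨s', hs', hxs', B, hBs, hB, hfpB, hBs', hss'⟩ :=
    hs.exists_extend_source (hsf p hpN₂).1 p.1
  have hφ : ContDiffOn ℝ ∞ (fun q => (q.1, (t₀ q).2.1)) t₀.source :=
    contDiffOn_fst.prodMk ht₀.1.snd.fst
  have hφd : ∀ q ∈ t₀.source, ∀ ξ, fderiv ℝ (fun q => (q.1, (t₀ q).2.1)) q ξ =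
      (ξ.1, (fderiv ℝ t₀ q ξ).2.1) := by
    intro q hq ξ
    rw [(hasFDerivAt_fst.prodMk (ht₀.differentiableAt hq).hasFDerivAt.snd.fst).fderiv]
    rfl
  have ht₀fst : ∀ q ∈ t₀.source, (t₀ q).1 = q.1 := fun q _ => by rw [ht₀ν]
  have hgl : ContDiffOn ℝ ∞ (fun q i => g (Sum.inl i) q) t₀.source :=
    _root_.contDiffOn_pi.2 fun i => (hg.1 _).mono ht₀N
  have hgld : ∀ q ∈ t₀.source, ∀ ξ, fderiv ℝ (fun q i => g (Sum.inl i) q) q ξ =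
      fun i => fderiv ℝ (g (Sum.inl i)) q ξ := by
    intro q hq ξ
    rw [(hg.hasFDerivAt_inl hN (ht₀N hq)).fderiv]
    rfl
  obtain ⟨N₁, hN₁t, hN₁, hpN₁, himage, γ, hγ, hγg⟩ := exists_smooth_factor t₀.open_source hφ hgl
    hpt₀ (by
      rintro ⟨x, v⟩
      obtain ⟨ξ, hξ⟩ := (ht₀.bijective_fderiv hpt₀).2 (x, v, 0)
      refine ⟨ξ, ?_⟩
      rw [hφd p hpt₀, ← fst_fderiv_eq ht₀ ht₀fst hpt₀, hξ]) (by
      intro q hq ξ hξ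
      rw [hφd q hq, Prod.mk_eq_zero] at hξ
      have h1 : ξ ∈ W q := by
        rw [hWt₀ q hq, mem_secondInputDistribution, fst_fderiv_eq ht₀ ht₀fst hq]
        exact hξ
      rw [hgld q hq]
      exact funext fun i => (hg.fderiv_mem (ht₀N hq) _).2 ξ h1)
  have hV : IsOpen (N₁ ∩ (N₂ ∩ f ⁻¹' B) ∩ Prod.fst ⁻¹' s'.source) :=
    (hN₁.inter ((hf.continuousOn.mono hN₂N).isOpen_inter_preimage hN₂ hB)).inter
      (s'.open_source.preimage continuous_fst)
  let t := t₀.restrOpen _ hV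
  have ht : IsLocalDiffeo t := ht₀.restrOpen hV
  have hpt : p ∈ t.source := ⟨hpt₀, ⟨hpN₁, hpN₂, hfpB⟩, hxs'⟩
  have htt₀ : t.source ⊆ t₀.source := fun q hq => hq.1
  have htN₁ : t.source ⊆ N₁ := fun q hq => hq.2.1.1
  have hsymm : ∀ q ∈ t.source, s' (f q) = (γ (q.1, (t q).2.1), (t q).2.1, (t q).2.2) := by
    intro q hq
    rw [hss' hq.2.1.2.2, (hsf q hq.2.1.2.1).2]
    refine Prod.ext ((hγg q (htN₁ hq))) ?_
    change _ = (t₀ q).2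
    rw [ht₀ν]
  have himage_le : (fun q => (q.1, (t q).2.1)) '' t.source ⊆
      (fun q => (q.1, (t₀ q).2.1)) '' N₁ := Set.image_mono htN₁
  have hnf : IsNormalForm f N p s'.symm t (fun y => γ (s'.symm y.1, y.2)) := by
    refine ⟨hs'.symm, ht, hpt, htt₀.trans ht₀N, fun q hq =>
      ⟨ht₀fst q (htt₀ hq), hq.2.2, hBs' hq.2.1.2.2⟩, ?_, fun q hq => ?_⟩
    · refine hγ.comp (t := (fun q => (q.1, (t₀ q).2.1)) '' N₁)
        (ContDiffOn.prodMk (hs'.2.comp contDiffOn_fst ?_) contDiffOn_snd) ?_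
      · rintro _ ⟨q, hq, rfl⟩
        exact s'.map_source hq.2.2
      · rintro _ ⟨q, hq, rfl⟩
        refine himage_le ⟨q, hq, ?_⟩
        exact Prod.ext (s'.left_inv hq.2.2).symm rfl
    · change s' (f q) = (γ (s'.symm (s' q.1), (t q).2.1), _)
      rw [s'.left_inv hq.2.2]
      exact hsymm q hq
  -- The set is the image of the open set `t.target` under the open projection that forgets `w`.
  have hΩ : IsOpen ((fun q => (q.1, (t q).2.1)) '' t.source) := by
    have h1 : (fun q => (q.1, (t q).2.1)) '' t.source =
        (Prod.map id Prod.fst : RVec n × RVec b × RVec k → RVec n × RVec b) '' t.target := by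
      rw [← t.image_source_eq_target, Set.image_image]
      refine Set.image_congr fun q hq => ?_
      exact Prod.ext (ht₀fst q (htt₀ hq)).symm rfl
    rw [h1]
    exact (IsOpenMap.id.prodMap isOpenMap_fst) _ t.open_target
  obtain ⟨pc, hpc, hppc, hpcΩ, hpce⟩ := exists_completion (a := a) (m := m) (by omega) hΩ
    (hγ.mono himage_le) (y := (p.1, (t p).2.1)) ⟨p, hpt, rfl⟩ (by
      intro α
      -- Prescribing `dgˡ = α` and `dv = 0` gives a vector whose `x`-part alone attains `α` under
      -- `dγ`.
      obtain ⟨ξ, hξ⟩ := hg.surjective hp (Sum.elim α 0)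
      refine ⟨ξ.1, ?_⟩
      have h1 := (hγ.differentiableAt_of_isOpen himage ⟨p, hpN₁, rfl⟩).hasFDerivAt.comp p
        (hφ.differentiableAt_of_isOpen t₀.open_source hpt₀).hasFDerivAt
      have h2 := h1.congr_of_eventuallyEq (f₁ := fun q i => g (Sum.inl i) q) (by
        filter_upwards [hN₁.mem_nhds hpN₁] with q hq using hγg q hq)
      have h3 := hgld p hpt₀ ξ
      rw [h2.fderiv, ContinuousLinearMap.comp_apply, hφd p hpt₀] at h3
      have h4 : (fderiv ℝ t₀ p ξ).2.1 = 0 := by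
        rw [show (t₀ : RVec n × RVec m → RVec n × RVec b × RVec k) =
          fun q => (q.1, newInputs f g τ q) from funext ht₀ν,
          (hasFDerivAt_fst.prodMk (hasFDerivAt_newInputs hN hf hg hp)).fderiv]
        exact funext fun j => congrFun hξ (Sum.inr j)
      rw [h4] at h3
      exact h3.trans (funext fun i => congrFun hξ (Sum.inl i)))
  refine ⟨s'.symm, t, γ, pc, hnf, fun q _ => ht₀ν q, fun q hq => hWt₀ q (htt₀ hq),
    hγ.mono himage_le, fun q hq i => (congrFun (hγg q (htN₁ hq)) i).symm, hpc, hppc, hpcΩ,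
    fun y _ => hpce y, fun z hz w hw => ?_⟩
  have hq := t.map_target hw
  have h1 := t.right_inv hw
  have h2 := hpce (pc.symm z)
  rw [pc.right_inv hz] at h2
  have h3 : s' (f (t.symm ((pc.symm z).1, z.2, w))) = (z.1.1, z.2, w) := by
    rw [hsymm _ hq, h1, h2.1, ← ht₀fst _ (htt₀ hq)]
    change (γ ((t _).1, _), _) = _
    rw [h1, h2.2]
  have h4 : f (t.symm ((pc.symm z).1, z.2, w)) ∈ s'.source := hBs' hq.2.1.2.2
  refine ⟨?_, ?_⟩
  · rw [← h3]
    exact s'.map_source h4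
  · rw [← h3]
    exact (s'.left_inv h4).symm

end Construction

/-! ### Sorting the functions: linear algebra of the selection -/

section Sorting

/-- Among functionals `A` whose common kernel has dimension `k` and functionals `B` with trivial
common kernel one can select altogether `dim V` with trivial common kernel, `k` of them from
`B`. -/
theorem exists_selection {V ι κ : Type*} [AddCommGroup V] [Module ℝ V] [FiniteDimensional ℝ V]
    [Finite ι] [Finite κ] (A : ι → Module.Dual ℝ V) (B : κ → Module.Dual ℝ V) {b k : ℕ}
    (hdim : b + k = Module.finrank ℝ V)
    (hA : Module.finrank ℝ (Submodule.span ℝ (Set.range A)).dualCoannihilator = k)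
    (hB : ∀ u, (∀ j, B j u = 0) → u = 0) :
    ∃ (r : Fin b → ι) (τ : Fin k → κ), Function.Injective r ∧
      ∀ u, (∀ j, A (r j) u = 0) → (∀ i, B (τ i) u = 0) → u = 0 := by
  set S := Submodule.span ℝ (Set.range A) with hS
  have hSb : Module.finrank ℝ S = b := by
    have := Subspace.finrank_add_finrank_dualCoannihilator_eq S
    omega
  have hQk : Module.finrank ℝ (Module.Dual ℝ V ⧸ S) = k := by
    have h1 := S.finrank_quotient_add_finrank
    rw [Subspace.dual_finrank_eq] at h1
    omega
  have hBtop : Submodule.span ℝ (Set.range B) = ⊤ := by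
    rw [eq_top_iff]
    intro β _
    exact mem_span_of_iInf_ker_le_ker fun u hu => by
      rw [hB u fun j => by simpa using (Submodule.mem_iInf _).1 hu j]
      exact Submodule.zero_mem _
  -- The `A (r j)` form a basis of `S = span A`, and the classes of the `B (τ i)` a basis of the
  -- quotient of the dual by `S`. The cardinalities are `b` and `k`.
  obtain ⟨ι', r, hr, hrspan, hrli⟩ := exists_linearIndependent' ℝ A
  obtain ⟨κ', τ, hτ, hτspan, hτli⟩ := exists_linearIndependent' ℝ (fun j => S.mkQ (B j))
  have : Finite ι' := Finite.of_injective r hr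
  have : Finite κ' := Finite.of_injective τ hτ
  have := Fintype.ofFinite ι'
  have := Fintype.ofFinite κ'
  have hspanQ : Submodule.span ℝ (Set.range fun j => S.mkQ (B j)) = ⊤ := by
    have h1 : Set.range (fun j => S.mkQ (B j)) = S.mkQ '' Set.range B := by
      rw [← Set.range_comp]; rfl
    rw [h1, ← Submodule.map_span, hBtop, Submodule.map_top, Submodule.range_mkQ]
  have hι' : Fintype.card ι' = b := by
    rw [← finrank_span_eq_card hrli, hrspan, hSb]
  have hκ' : Fintype.card κ' = k := by
    rw [← finrank_span_eq_card hτli, hτspan, hspanQ, finrank_top, hQk]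
  let e := (Fintype.equivFinOfCardEq hι').symm
  let e' := (Fintype.equivFinOfCardEq hκ').symm
  refine ⟨r ∘ e, τ ∘ e', hr.comp e.injective, fun u h1 h2 => hB u fun j => ?_⟩
  have hSu : S ≤ LinearMap.ker (Module.Dual.eval ℝ V u) := by
    rw [hS, ← hrspan, Submodule.span_le]
    rintro _ ⟨i, rfl⟩
    have := h1 (e.symm i)
    simpa using this
  -- Evaluation at `u` kills `S`, descends to the quotient, and vanishes there on a basis; hence
  -- every `B j` vanishes at `u`.
  have hQu : S.liftQ _ hSu = 0 := by
    refine LinearMap.ext_on (s := Set.range ((fun j => S.mkQ (B j)) ∘ τ)) ?_ ?_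
    · rw [hτspan, hspanQ]
    · rintro _ ⟨i, rfl⟩
      have := h2 (e'.symm i)
      simpa using this
  exact DFunLike.congr_fun hQu (S.mkQ (B j))

/-- Turns an injective choice of indices into a sorting of the whole family, with the chosen ones in
the slots reserved for `v`. -/
theorem exists_perm_extending {α β : Type*} [Finite α] (i r : β → α) (hi : Function.Injective i)
    (hr : Function.Injective r) : ∃ σ : Equiv.Perm α, ∀ x, σ (i x) = r x := by
  classical
  have := Fintype.ofFinite α
  let e : {x // x ∈ Set.range i} ≃ {x // x ∈ Set.range r} :=
    (Equiv.ofInjective i hi).symm.trans (Equiv.ofInjective r hr)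
  refine ⟨e.extendSubtype, fun x => ?_⟩
  rw [e.extendSubtype_apply_of_mem _ ⟨x, rfl⟩]
  have : (Equiv.ofInjective i hi).symm ⟨i x, ⟨x, rfl⟩⟩ = x :=
    Equiv.ofInjective_symm_apply hi x
  simp only [e, Equiv.trans_apply, this, Equiv.ofInjective_apply]

end Sorting

/-! ### Dimensions, existence of the construction, maximality -/

section System

variable {n m k : ℕ} {f : RVec n × RVec m → RVec n}
  {N : Set (RVec n × RVec m)} {p : RVec n × RVec m} {W : TangentDistribution (RVec n × RVec m)}

theorem IsProjectableDistributionOn.finrank_eq (h : IsProjectableDistributionOn f W k N)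
    {q : RVec n × RVec m} (hq : q ∈ N) : Module.finrank ℝ (W q) = k := by
  obtain ⟨-, w, hw, -⟩ := h
  rw [(hw.2 q hq).2, finrank_span_eq_card (hw.2 q hq).1, Fintype.card_fin]

/-- A vertical subspace is isomorphic to its space of `u`-components. -/
theorem finrank_comap_inr (S : Submodule ℝ (RVec n × RVec m)) (hS : S ≤ verticalSpace n m) :
    Module.finrank ℝ (S.comap (LinearMap.inr ℝ (RVec n) (RVec m))) = Module.finrank ℝ S := by
  have h1 : (S.comap (LinearMap.inr ℝ (RVec n) (RVec m))).map (LinearMap.inr ℝ (RVec n) (RVec m)) =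
      S := by
    refine Submodule.map_comap_eq_self fun ξ hξ => ⟨ξ.2, ?_⟩
    exact Prod.ext (mem_verticalSpace.1 (hS hξ)).symm rfl
  exact (Submodule.equivMapOfInjective _ LinearMap.inr_injective _).finrank_eq.trans (by rw [h1])

theorem finrank_le_of_le_verticalSpace (S : Submodule ℝ (RVec n × RVec m))
    (hS : S ≤ verticalSpace n m) : Module.finrank ℝ S ≤ m := by
  rw [← finrank_comap_inr S hS]
  exact (Submodule.finrank_le _).trans (by simp)

/-- The functions of an exact basis can be sorted. -/
theorem exists_isSorted {a b : ℕ} {g : Fin a ⊕ Fin b → RVec n × RVec m → ℝ} (hN : IsOpen N)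
    (hp : p ∈ N) (hf : ContDiffOn ℝ ∞ f N)
    (hinj : ∀ c ∈ verticalSpace n m, fderiv ℝ f p c = 0 → c = 0) (hm : b + k = m)
    (hW : W p ≤ verticalSpace n m) (hk : Module.finrank ℝ (W p) = k)
    (hg : IsExactBasisOn g (reducedCodistribution f W) N) :
    ∃ (σ : Equiv.Perm (Fin a ⊕ Fin b)) (τ : Fin k → Fin n),
      IsSorted f (fun i => g (σ i)) τ p := by
  let A : Fin a ⊕ Fin b → Module.Dual ℝ (RVec m) := fun i =>
    (fderiv ℝ (g i) p).toLinearMap ∘ₗ LinearMap.inr ℝ (RVec n) (RVec m)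
  let B : Fin n → Module.Dual ℝ (RVec m) := fun j =>
    LinearMap.proj j ∘ₗ (fderiv ℝ f p).toLinearMap ∘ₗ LinearMap.inr ℝ (RVec n) (RVec m)
  have hfp := hf.differentiableAt_of_isOpen hN hp
  -- The restrictions of the `dgⁱ` to the `u`-directions have `W` as common kernel; this supplies
  -- the dimension `k` required for the selection.
  have hA : (Submodule.span ℝ (Set.range A)).dualCoannihilator =
      (W p).comap (LinearMap.inr ℝ (RVec n) (RVec m)) := by
    ext u
    rw [Submodule.mem_dualCoannihilator, Submodule.mem_comap,
      mem_iff_forall_fderiv_eq_zero hg hp hfp hinj hW]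
    constructor
    · exact fun h => ⟨rfl, fun i => h (A i) (Submodule.subset_span ⟨i, rfl⟩)⟩
    · rintro ⟨-, h⟩ φ hφ
      have h1 : Submodule.span ℝ (Set.range A) ≤ LinearMap.ker (Module.Dual.eval ℝ (RVec m) u) := by
        rw [Submodule.span_le]
        rintro _ ⟨i, rfl⟩
        exact h i
      exact h1 hφ
  obtain ⟨r, τ, hr, hrτ⟩ := exists_selection A B (b := b) (k := k) (by simp [hm])
    (by rw [hA, finrank_comap_inr _ hW, hk]) fun u hu => by
      have h1 := hinj (0, u) (mem_verticalSpace.2 rfl) (funext hu)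
      exact congrArg Prod.snd h1
  obtain ⟨σ, hσ⟩ := exists_perm_extending Sum.inr r Sum.inr_injective hr
  have hg' := hg.reindex σ
  refine ⟨σ, τ, ?_⟩
  have hinjective : Function.Injective
      ((fderiv ℝ (newInputs f (fun i => g (σ i)) τ) p).comp
        (ContinuousLinearMap.inr ℝ (RVec n) (RVec m))) := by
    refine (injective_iff_map_eq_zero _).2 fun u hu => ?_
    rw [(hasFDerivAt_newInputs hN hf hg' hp).fderiv] at hu
    refine hrτ u (fun j => ?_) fun i => ?_
    · have h1 := congrFun (congrArg Prod.fst hu) j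
      rw [← hσ j]
      exact h1
    · exact congrFun (congrArg Prod.snd hu) i
  refine ⟨hinjective, ?_⟩
  refine (LinearMap.injective_iff_surjective_of_finrank_eq_finrank
    (f := ((fderiv ℝ (newInputs f (fun i => g (σ i)) τ) p).comp
        (ContinuousLinearMap.inr ℝ (RVec n) (RVec m))).toLinearMap) ?_).1 hinjective
  simp [hm]

/-- The codistribution `P₁` has dimension `n - k`. -/
theorem card_add_eq_of_isExactBasisOn {ι : Type*} [Fintype ι] {g : ι → RVec n × RVec m → ℝ}
    {q : RVec n × RVec m} (hq : q ∈ N) (hfq : DifferentiableAt ℝ f q)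
    (hsub : Function.Surjective (fderiv ℝ f q))
    (hinj : ∀ c ∈ verticalSpace n m, fderiv ℝ f q c = 0 → c = 0)
    (hW : W q ≤ verticalSpace n m) (hk : Module.finrank ℝ (W q) = k)
    (hg : IsExactBasisOn g (reducedCodistribution f W) N) : Fintype.card ι + k = n := by
  let L : RVec n × RVec m →ₗ[ℝ] ι → ℝ := LinearMap.pi fun i => (fderiv ℝ (g i) q).toLinearMap
  let K := LinearMap.ker (fderiv ℝ f q).toLinearMap
  -- The sum is direct, `ker df` has dimension `m` and `W` dimension `k`, so rank-nullity for `dg`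
  -- gives `card ι + m + k = n + m`.
  have hL : LinearMap.ker L = K ⊔ W q := by
    refine le_antisymm (fun ξ hξ => ?_) (sup_le (fun ξ hξ => ?_) fun ξ hξ => ?_)
    · by_contra hne
      obtain ⟨μ, hμ, hle⟩ := Submodule.exists_le_ker_of_notMem hne
      have h1 : LinearMap.toContinuousLinearMap μ ∈ reducedCodistribution f W q :=
        ⟨(mem_spanDifferentials_iff hfq _).2 fun η hη => hle (Submodule.mem_sup_left hη),
          fun w hw => hle (Submodule.mem_sup_right hw)⟩
      exact hμ ((hg.mem_iff hq _).1 h1 ξ (congrFun hξ))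
    · exact funext fun i =>
        (mem_spanDifferentials_iff hfq _).1 (hg.fderiv_mem hq i).1 ξ hξ
    · exact funext fun i => (hg.fderiv_mem hq i).2 ξ hξ
  have hdisj : K ⊓ W q = ⊥ := by
    rw [eq_bot_iff]
    exact fun ξ hξ => hinj ξ (hW hξ.2) hξ.1
  have h1 := L.finrank_range_add_finrank_ker
  have h2 := (fderiv ℝ f q).toLinearMap.finrank_range_add_finrank_ker
  have h3 := Submodule.finrank_sup_add_finrank_inf_eq K (W q)
  rw [LinearMap.range_eq_top.2 (hg.surjective hq : Function.Surjective L), finrank_top, hL] at h1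
  rw [LinearMap.range_eq_top.2 hsub, finrank_top] at h2
  rw [hdisj, finrank_bot, hk] at h3
  simp only [Module.finrank_prod, Module.finrank_pi, Fintype.card_fin] at h1 h2
  change n + Module.finrank ℝ K = n + m at h2
  omega

/-- Everything about the construction of the normal form from a distribution `W`. -/
theorem exists_construction (hN : IsOpen N) (hp : p ∈ N) (hf : ContDiffOn ℝ ∞ f N)
    (hsub : ∀ q ∈ N, Function.Surjective (fderiv ℝ f q)) (hmn : m ≤ n)
    (hinj : ∀ q ∈ N, ∀ c ∈ verticalSpace n m, fderiv ℝ f q c = 0 → c = 0)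
    (hW : IsProjectableDistributionOn f W k N)
    (hP : IsIntegrableOn (reducedCodistribution f W) N) :
    ∃ a b : ℕ, a + b + k = n ∧ b + k = m ∧
      (∃ N' ⊆ N, IsOpen N' ∧ p ∈ N' ∧ ∃ g : Fin a ⊕ Fin b → RVec n × RVec m → ℝ,
        IsExactBasisOn g (reducedCodistribution f W) N') ∧
      ∀ N' ⊆ N, IsOpen N' → p ∈ N' → ∀ g : Fin a ⊕ Fin b → RVec n × RVec m → ℝ,
        IsExactBasisOn g (reducedCodistribution f W) N' →
          (∃ (σ : Equiv.Perm (Fin a ⊕ Fin b)) (τ : Fin k → Fin n),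
            IsSorted f (fun i => g (σ i)) τ p) ∧
          ∀ τ : Fin k → Fin n, IsSorted f g τ p →
            ConstructionYieldsNormalForm f N' p W g τ := by
  have hkm : k ≤ m := hW.finrank_eq hp ▸ finrank_le_of_le_verticalSpace _ (hW.1 p hp)
  have hn : (n - m) + (m - k) + k = n := by omega
  have hm : (m - k) + k = m := by omega
  refine ⟨n - m, m - k, hn, hm, ?_, fun N' hN'N hN' hpN' g hg => ⟨?_, fun τ hτ => ?_⟩⟩
  · obtain ⟨N', hN'N, hN', hpN', r, g, hg⟩ := hP p hp
    have hr := card_add_eq_of_isExactBasisOn hpN' (hf.differentiableAt_of_isOpen hN hp)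
      (hsub p hp) (hinj p hp) (hW.1 p hp) (hW.finrank_eq hp) hg
    rw [Fintype.card_fin] at hr
    exact ⟨N', hN'N, hN', hpN', _, hg.reindex (finSumFinEquiv.trans (finCongr (by omega)))⟩
  · exact exists_isSorted hN' hpN' (hf.mono hN'N) (hinj p hp) hm (hW.1 p hp) (hW.finrank_eq hp) hg
  · exact constructionYieldsNormalForm hN' hpN' (hf.mono hN'N) (fun q hq => hsub q (hN'N hq)) hn hm
      (fun q hq => hW.1 q (hN'N hq)) (fun q hq => hW.finrank_eq (hN'N hq)) hg hτ

/-- The normal form and an involutive complement near `p`. -/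
theorem hasNormalForm_and_hasInvolutiveComplementOn (hN : IsOpen N) (hp : p ∈ N)
    (hf : ContDiffOn ℝ ∞ f N) (hsub : ∀ q ∈ N, Function.Surjective (fderiv ℝ f q)) (hmn : m ≤ n)
    (hinj : ∀ q ∈ N, ∀ c ∈ verticalSpace n m, fderiv ℝ f q c = 0 → c = 0)
    (hW : IsProjectableDistributionOn f W k N)
    (hP : IsIntegrableOn (reducedCodistribution f W) N) :
    HasNormalForm f N p k ∧ ∃ N' ⊆ N, IsOpen N' ∧ p ∈ N' ∧ HasInvolutiveComplementOn W N' := by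
  obtain ⟨a, b, hn, hm, ⟨N', hN'N, hN', hpN', g, hg⟩, hall⟩ :=
    exists_construction hN hp hf hsub hmn hinj hW hP
  obtain ⟨σ, τ, hστ⟩ := (hall N' hN'N hN' hpN' g hg).1
  obtain ⟨h, t, γ, pc, hnf, -, hWt, -⟩ :=
    (hall N' hN'N hN' hpN' _ (hg.reindex σ)).2 τ hστ
  have hnf' := hnf.mono hN'N
  refine ⟨⟨a, b, hn, hm, h, t, _, hnf'⟩,
    t.source, hnf'.2.2.2.1, t.open_source, hnf'.2.2.1, ?_⟩
  -- In the coordinates of the construction `W = span(∂_w)`, so `span(∂_v)` serves as complement.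
  obtain ⟨V, c, v, hv, hV, hc⟩ := hasInvolutiveComplementOn_secondInputDistribution hnf'.2.1
    fun q hq => (hnf'.2.2.2.2.1 q hq).1
  refine ⟨V, c, v, hv, hV, fun q hq => ?_⟩
  rw [show W q = secondInputDistribution t q from hWt q hq]
  exact hc q hq

variable {O : Set (RVec n × RVec m)}

theorem HasNormalForm.mono (h : HasNormalForm f N p k) (hNO : N ⊆ O) : HasNormalForm f O p k := by
  obtain ⟨a, b, hn, hm, h, t, G, hnf⟩ := h
  exact ⟨a, b, hn, hm, h, t, G, hnf.mono hNO⟩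

/-- Transfers upper bounds on the dimension of projectable distributions to the number of inputs `w`
in a normal form. -/
theorem HasNormalForm.mem_projectableDimensions (hO : IsOpen O) (hf : ContDiffOn ℝ ∞ f O)
    (h : HasNormalForm f O p k) : k ∈ projectableDimensions f O p := by
  obtain ⟨a, b, hn, hm, h, t, G, hnf⟩ := h
  exact ⟨t.source, hnf.2.2.2.1, t.open_source, hnf.2.2.1, _, hnf.isProjectableDistributionOn hO hf⟩

/-- A distribution spanned by projectable fields is near `p` contained in every distribution that
contains all projectable fields. -/
theorem IsProjectableDistributionOn.eventually_le (hN : IsOpen N) (hNO : N ⊆ O) (hp : p ∈ N)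
    (hW : IsProjectableDistributionOn f W k N) {D : TangentDistribution (RVec n × RVec m)}
    (hD : NoProjectableOutside f O p D) : ∀ᶠ q in 𝓝 p, W q ≤ D q := by
  obtain ⟨hWU, w, hw, hwp⟩ := hW
  have h1 : ∀ i, ∀ᶠ q in 𝓝 p, w i q ∈ D q := fun i =>
    hD N hNO hN hp (w i) (fun q hq => hWU q hq (by
      rw [(hw.2 q hq).2]
      exact Submodule.subset_span ⟨i, rfl⟩)) (hwp i)
  filter_upwards [Filter.eventually_all.2 h1, hN.mem_nhds hp] with q hq hqN
  rw [(hw.2 q hqN).2, Submodule.span_le]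
  rintro _ ⟨i, rfl⟩
  exact hq i

theorem NoProjectableOutside.le_of_mem (hp : p ∈ N) (hW : IsProjectableDistributionOn f W k N)
    (h : NoProjectableOutside f O p W) {j : ℕ} (hj : j ∈ projectableDimensions f O p) : j ≤ k := by
  obtain ⟨M, hMO, hM, hpM, D, hD⟩ := hj
  rw [← hD.finrank_eq hpM, ← hW.finrank_eq hp]
  exact Submodule.finrank_mono (hD.eventually_le hM hMO hpM h).self_of_nhds

/-- The regular span `D` of the projectable fields contains `W` near `p`, and its dimension is at
most `k`; so `W = D` there and `W` inherits the property of `D`. -/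
theorem noProjectableOutside_of_isGreatest (hN : IsOpen N) (hNO : N ⊆ O) (hp : p ∈ N)
    (hW : IsProjectableDistributionOn f W k N) (hreg : ProjectableFieldsRegular f O p)
    (hk : IsGreatest (projectableDimensions f O p) k) : NoProjectableOutside f O p W := by
  obtain ⟨M, hMO, hM, hpM, D, j, hD, hDout⟩ := hreg
  have hjk : j ≤ k := hk.2 ⟨M, hMO, hM, hpM, D, hD⟩
  have heq : ∀ᶠ q in 𝓝 p, W q = D q := by
    filter_upwards [hW.eventually_le hN hNO hp hDout, hN.mem_nhds hp, hM.mem_nhds hpM]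
      with q hq hqN hqM
    refine Submodule.eq_of_le_of_finrank_le hq ?_
    rw [hD.finrank_eq hqM, hW.finrank_eq hqN]
    exact hjk
  intro N' hN'O hN' hpN' v hv hvp
  filter_upwards [hDout N' hN'O hN' hpN' v hv hvp, heq] with q hq hq'
  rw [hq']
  exact hq

theorem eq_zero_of_finrank_range_eq {q : RVec n × RVec m}
    (h : Module.finrank ℝ (LinearMap.range
      ((fderiv ℝ f q).comp (ContinuousLinearMap.inr ℝ (RVec n) (RVec m))).toLinearMap) = m) :
    ∀ c ∈ verticalSpace n m, fderiv ℝ f q c = 0 → c = 0 := by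
  intro c hc hfc
  have h1 := LinearMap.finrank_range_add_finrank_ker
    ((fderiv ℝ f q).comp (ContinuousLinearMap.inr ℝ (RVec n) (RVec m))).toLinearMap
  rw [h, Module.finrank_fin_fun, Nat.add_eq_left, Submodule.finrank_eq_zero] at h1
  have h2 : (0, c.2) = c := Prod.ext (mem_verticalSpace.1 hc).symm rfl
  have h3 : c.2 ∈ LinearMap.ker
      ((fderiv ℝ f q).comp (ContinuousLinearMap.inr ℝ (RVec n) (RVec m))).toLinearMap := by
    change fderiv ℝ f q (0, c.2) = 0
    rw [h2, hfc]
  rw [h1, Submodule.mem_bot] at h3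
  rw [← h2, h3, Prod.mk_zero_zero]

end System

/-! ### The main theorem -/

theorem mainTheorem3 (n m : ℕ) (O : Set (RVec n × RVec m)) (hO : IsOpen O)
    (f : RVec n × RVec m → RVec n) (hf : ContDiffOn ℝ ∞ f O)
    (hsubmersion : ∀ q ∈ O, Function.Surjective (fderiv ℝ f q))
    (hrank : ∀ q ∈ O, Module.finrank ℝ (LinearMap.range
      ((fderiv ℝ f q).comp (ContinuousLinearMap.inr ℝ (RVec n) (RVec m))).toLinearMap) = m)
    (p : RVec n × RVec m) (hp : p ∈ O) :
    (∀ k : ℕ, 1 ≤ k →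
      (HasNormalForm f O p k ↔
        ∃ N ⊆ O, IsOpen N ∧ p ∈ N ∧ ∃ W : TangentDistribution (RVec n × RVec m),
          IsProjectableDistributionOn f W k N ∧
          (IsIntegrableOn (reducedCodistribution f W) N ∧
            IsVerticalCauchyCharacteristicOn W (reducedCodistribution f W) N) ∧
          HasInvolutiveComplementOn W N)) ∧
    (∀ (k : ℕ) (N : Set (RVec n × RVec m)) (W : TangentDistribution (RVec n × RVec m)),
      1 ≤ k → N ⊆ O → IsOpen N → p ∈ N →
      IsProjectableDistributionOn f W k N →
      IsIntegrableOn (reducedCodistribution f W) N →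
      IsVerticalCauchyCharacteristicOn W (reducedCodistribution f W) N →
        IsInvolutiveOn W N ∧
        (∃ N' ⊆ N, IsOpen N' ∧ p ∈ N' ∧ HasInvolutiveComplementOn W N') ∧
        (NoProjectableOutside f O p W →
          IsGreatest (projectableDimensions f O p) k ∧
          IsGreatest {j | HasNormalForm f O p j} k) ∧
        (ProjectableFieldsRegular f O p →
          (IsGreatest (projectableDimensions f O p) k ↔ NoProjectableOutside f O p W)) ∧
        ∃ a b : ℕ, a + b + k = n ∧ b + k = m ∧
          (∃ N' ⊆ N, IsOpen N' ∧ p ∈ N' ∧ ∃ g : Fin a ⊕ Fin b → RVec n × RVec m → ℝ,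
            IsExactBasisOn g (reducedCodistribution f W) N') ∧
          ∀ N' ⊆ N, IsOpen N' → p ∈ N' → ∀ g : Fin a ⊕ Fin b → RVec n × RVec m → ℝ,
            IsExactBasisOn g (reducedCodistribution f W) N' →
              (∃ (σ : Equiv.Perm (Fin a ⊕ Fin b)) (τ : Fin k → Fin n),
                IsSorted f (fun i => g (σ i)) τ p) ∧
              ∀ τ : Fin k → Fin n, IsSorted f g τ p →
                ConstructionYieldsNormalForm f N' p W g τ) := by
  have hinj : ∀ q ∈ O, ∀ c ∈ verticalSpace n m, fderiv ℝ f q c = 0 → c = 0 := fun q hq =>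
    eq_zero_of_finrank_range_eq (hrank q hq)
  have hmn : m ≤ n := by
    rw [← hrank p hp]
    exact (Submodule.finrank_le _).trans (by simp)
  refine ⟨fun k _ => ⟨?_, ?_⟩, fun k N W _ hNO hN hpN hW hP _ => ?_⟩
  · rintro ⟨a, b, -, -, h, t, G, hnf⟩
    have hP := (hnf.isExactBasisOn hO hf hsubmersion).isIntegrableOn t.open_source
    have htO := hnf.2.2.2.1
    exact ⟨t.source, htO, t.open_source, hnf.2.2.1, secondInputDistribution t,
      hnf.isProjectableDistributionOn hO hf,
      ⟨hP, isVerticalCauchyCharacteristicOn_of_isIntegrableOn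
        (fun q hq => hnf.differentiableAt hO hf hq) (fun q hq => hinj q (htO hq))
        (fun q hq => hnf.secondInputDistribution_le hq) hP⟩,
      hasInvolutiveComplementOn_secondInputDistribution hnf.2.1
        fun q hq => (hnf.2.2.2.2.1 q hq).1⟩
  · rintro ⟨N, hNO, hN, hpN, W, hW, ⟨hP, -⟩, -⟩
    exact (hasNormalForm_and_hasInvolutiveComplementOn hN hpN (hf.mono hNO)
      (fun q hq => hsubmersion q (hNO hq)) hmn (fun q hq => hinj q (hNO hq)) hW hP).1.mono hNO
  · have hfN := hf.mono hNO
    have hsubN : ∀ q ∈ N, Function.Surjective (fderiv ℝ f q) := fun q hq => hsubmersion q (hNO hq)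
    have hinjN : ∀ q ∈ N, ∀ c ∈ verticalSpace n m, fderiv ℝ f q c = 0 → c = 0 :=
      fun q hq => hinj q (hNO hq)
    obtain ⟨hnf, hcomp⟩ :=
      hasNormalForm_and_hasInvolutiveComplementOn hN hpN hfN hsubN hmn hinjN hW hP
    have hgreatest : NoProjectableOutside f O p W →
        IsGreatest (projectableDimensions f O p) k := fun h =>
      ⟨⟨N, hNO, hN, hpN, W, hW⟩, fun j hj => h.le_of_mem hpN hW hj⟩
    exact ⟨isInvolutiveOn_of_isIntegrableOn_reducedCodistribution
        (fun q hq => hf.differentiableAt_of_isOpen hO (hNO hq)) hinjN hW.1 hP, hcomp,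
      fun h => ⟨hgreatest h, hnf.mono hNO,
        fun j hj => h.le_of_mem hpN hW (HasNormalForm.mem_projectableDimensions hO hf hj)⟩,
      fun hreg => ⟨noProjectableOutside_of_isGreatest hN hNO hpN hW hreg, hgreatest⟩,
      exists_construction hN hpN hfN hsubN hmn hinjN hW hP⟩
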